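/- Let $M$ be a smooth manifold (Hausdorff, second countable, without boundary, of finite dimension $n$). Let $\underline{\mathbb R}$ be the sheaf of locally constant real-valued functions on $M$, let $\mathcal A^{\bullet}\colon \mathcal A^0\xrightarrow{d}\mathcal A^1\xrightarrow{d}\mathcal A^2\to\cdots$ be the complex of sheaves of $C^\infty$ differential forms on $M$ with the exterior derivative, and let $H^k_{\mathrm{dR}}(M)=h^k(\mathcal A^{\bullet}(M))$ be the de Rham cohomology of $M$. For a sheaf $\mathcal F$ let $\mathcal F\to\mathcal C^{0}\mathcal F\to\mathcal C^{1}\mathcal F\to\cdots$ be its Godement canonical resolution: $\mathcal C^0\mathcal F(U)=\prod_{x\in U}\mathcal F_x$, $\mathcal Q^0=\mathcal F$, $\mathcal Q^{p+1}=\mathcal C^0\mathcal Q^{p}/\mathcal Q^{p}$ and $\mathcal C^{p}\mathcal F=\mathcal C^0\mathcal Q^{p}$, with differential $\delta$ the composite $\mathcal C^0\mathcal Q^p\to\mathcal Q^{p+1}\to\mathcal C^0\mathcal Q^{p+1}$. The sheaf cohomology is $H^k(M,\mathcal F)=h^k(\Gamma(M,\mathcal C^{\bullet}\mathcal F))$.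 The hypercohomology $\mathbb H^k(M,\mathcal A^{\bullet})$ is the $k$-th cohomology of the total complex, with differential $D=\delta+(-1)^p d$, of the double complex $K^{p,q}=\Gamma(M,\mathcal C^{p}\mathcal A^{q})$. Then for every $k\ge 0$ the canonical maps $$H^k_{\mathrm{dR}}(M)\longrightarrow \mathbb H^k(M,\mathcal A^{\bullet})\longleftarrow H^k(M,\underline{\mathbb R}),$$ induced by the inclusions $\mathcal A^q(M)\hookrightarrow\Gamma(M,\mathcal C^0\mathcal A^q)$ and by the inclusion $\underline{\mathbb R}\hookrightarrow\mathcal A^0$ respectively, are isomorphisms of real vector spaces. Hence there is a canonical isomorphism $H^k_{\mathrm{dR}}(M)\cong H^k(M,\underline{\mathbb R})$, namely the unique one that is compatible with these two maps. -/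

import Mathlib

open CategoryTheory CategoryTheory.Limits TopologicalSpace Opposite
open scoped ContDiff Manifold Topology

universe u v

noncomputable section

namespace DeRham

/-! ### Preliminaries: instances -/

instance forgetModulePreservesFilteredColimits (R : Type) [Ring R] :
    PreservesFilteredColimitsOfSize.{u, u} (forget (ModuleCat.{u} R)) :=
  Limits.comp_preservesFilteredColimits (forget₂ (ModuleCat R) AddCommGrpCat.{u})
    (forget AddCommGrpCat)

instance hasSheafifyModule (R : Type) [Ring R] (X : TopCat.{u}) :
    HasSheafify (Opens.grothendieckTopology X) (ModuleCat.{u} R) := inferInstance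

instance abelianSheafModule (R : Type) [Ring R] (X : TopCat.{u}) :
    Abelian (TopCat.Sheaf (ModuleCat.{u} R) X) := TopCat.Sheaf.instAbelian

instance preadditiveSheafModule (R : Type) [Ring R] (X : TopCat.{u}) :
    Preadditive (TopCat.Sheaf (ModuleCat.{u} R) X) := Abelian.toPreadditive

/-- The signs `(-1)^p` of the total complex `D = δ + (-1)^p d` of a first-quadrant double complex. -/
instance tensorSignsUpNat : (ComplexShape.up ℕ).TensorSigns where
  ε' := MonoidHom.mk' (fun (i : ℕ) => (-1 : ℤˣ) ^ i) (pow_add (-1 : ℤˣ))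
  rel_add p q r (hpq : p + 1 = q) := show p + r + 1 = q + r by lia
  add_rel p q r (hpq : p + 1 = q) := show r + p + 1 = r + q by lia
  ε'_succ p q (hpq : p + 1 = q) := by
    subst hpq
    change (-1 : ℤˣ) ^ (p + 1) = -(-1 : ℤˣ) ^ p
    rw [pow_succ, mul_neg, mul_one]

/-! ### Sheaves of functions -/

/-- A family of submodules `carrier U` of the modules `∏_{x ∈ U} V x` of all dependent functions on
the open sets `U` of `X`, which is closed under restriction and is of local nature. -/
structure FunctionSheaf (R : Type) [Ring R] (X : TopCat.{u}) (V : X → Type v)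
    [∀ x, AddCommGroup (V x)] [∀ x, Module R (V x)] where
  carrier (U : Opens X) : Submodule R (∀ x : U, V x)
  restrict_mem {U W : Opens X} (h : W ≤ U) (f : ∀ x : U, V x) (hf : f ∈ carrier U) :
    (fun x : W => f ⟨x, h x.2⟩) ∈ carrier W
  local_mem (U : Opens X) (f : ∀ x : U, V x)
    (hf : ∀ x : U, ∃ (W : Opens X) (h : W ≤ U), x.1 ∈ W ∧
      (fun y : W => f ⟨y, h y.2⟩) ∈ carrier W) : f ∈ carrier U

namespace FunctionSheaf

variable {R : Type} [Ring R] {X : TopCat.{u}} {V : X → Type v}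
    [∀ x, AddCommGroup (V x)] [∀ x, Module R (V x)] (S : FunctionSheaf R X V)

/-- The presheaf of `R`-modules `U ↦ carrier U`. -/
def presheaf : TopCat.Presheaf (ModuleCat.{max u v} R) X where
  obj U := ModuleCat.of R (S.carrier U.unop)
  map {U W} i := ModuleCat.ofHom
    { toFun := fun f => ⟨fun x => f.1 ⟨x, i.unop.le x.2⟩, S.restrict_mem i.unop.le f.1 f.2⟩
      map_add' := fun _ _ => rfl
      map_smul' := fun _ _ => rfl }

end FunctionSheaf

namespace FunctionSheaf

variable {R : Type} [Ring R] {X : TopCat.{u}} {V : X → Type v}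
    [∀ x, AddCommGroup (V x)] [∀ x, Module R (V x)] (S : FunctionSheaf R X V)

theorem isSheaf : TopCat.Presheaf.IsSheaf S.presheaf := by
  rw [TopCat.Presheaf.isSheaf_iff_isSheafUniqueGluing]
  intro ι U sf hsf
  have hsf' : ∀ (i j : ι) (x : X) (hi : x ∈ U i) (hj : x ∈ U j),
      (sf i).1 ⟨x, hi⟩ = (sf j).1 ⟨x, hj⟩ := by
    intro i j x hi hj
    have := congrArg (fun f => f.1 ⟨x, (⟨hi, hj⟩ : x ∈ U i ⊓ U j)⟩) (hsf i j)
    exact this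
  have hmem : ∀ x : (iSup U : Opens X), ∃ i, x.1 ∈ U i := fun x => Opens.mem_iSup.1 x.2
  choose idx hidx using hmem
  refine ⟨⟨fun x => (sf (idx x)).1 ⟨x, hidx x⟩, ?_⟩, ?_, ?_⟩
  · refine S.local_mem _ _ fun x => ⟨U (idx x), le_iSup U _, hidx x, ?_⟩
    convert (sf (idx x)).2 using 1
    funext y
    exact hsf' _ _ _ _ _
  · intro i
    apply Subtype.ext
    funext y
    exact hsf' _ _ _ _ _
  · intro g hg
    apply Subtype.ext
    funext x
    have := congrArg (fun f => f.1 ⟨x.1, hidx x⟩) (hg (idx x))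
    exact this

/-- The sheaf of `R`-modules `U ↦ carrier U`. -/
def sheaf : TopCat.Sheaf (ModuleCat.{max u v} R) X :=
  ⟨S.presheaf, S.isSheaf⟩

variable {V' : X → Type v} [∀ x, AddCommGroup (V' x)] [∀ x, Module R (V' x)]

/-- The morphism of sheaves given by linear maps `carrier U → carrier' U` which commute with
restriction. -/
def homMk {S : FunctionSheaf R X V} {S' : FunctionSheaf R X V'}
    (φ : ∀ U : Opens X, S.carrier U →ₗ[R] S'.carrier U)
    (hφ : ∀ (U W : Opens X) (h : W ≤ U) (f : S.carrier U) (x : W),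
      (φ W ⟨fun y => f.1 ⟨y, h y.2⟩, S.restrict_mem h f.1 f.2⟩).1 x = (φ U f).1 ⟨x, h x.2⟩) :
    S.sheaf ⟶ S'.sheaf :=
  ObjectProperty.homMk
    { app := fun U => ModuleCat.ofHom (φ U.unop)
      naturality := fun U W i => by
        apply ModuleCat.hom_ext
        apply LinearMap.ext
        intro f
        apply Subtype.ext
        funext x
        exact hφ U.unop W.unop i.unop.le f x }

variable (R V) in
/-- All (arbitrary, discontinuous) sections of a family of modules. -/
def all : FunctionSheaf R X V where
  carrier _ := ⊤
  restrict_mem _ _ _ := Submodule.mem_top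
  local_mem _ _ _ := Submodule.mem_top

end FunctionSheaf

/-! ### Edge maps into the total complex of a double complex -/

section Edge

variable {C : Type*} [Category* C] [Preadditive C]
  (K : HomologicalComplex₂ C (ComplexShape.up ℕ) (ComplexShape.up ℕ))
  [K.HasTotal (ComplexShape.up ℕ)] (A : CochainComplex C ℕ)

/-- A map from a complex to the column `p = 0` of a double complex which is killed by the horizontal
differential gives a map to the total complex. -/
def columnToTotal (f : A ⟶ K.X 0) (hf : f ≫ K.d 0 1 = 0) : A ⟶ K.total (ComplexShape.up ℕ) where
  f q := f.f q ≫ K.ιTotal (ComplexShape.up ℕ) 0 q q (zero_add q)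
  comm' q q' hq := by
    obtain rfl : q + 1 = q' := hq
    have h1 : K.d₁ (ComplexShape.up ℕ) 0 q (q + 1) =
        (K.d 0 1).f q ≫ K.ιTotal (ComplexShape.up ℕ) 1 q (q + 1) (add_comm 1 q) := by
      rw [K.d₁_eq (ComplexShape.up ℕ) (i₁' := 1) rfl q (q + 1) (add_comm 1 q)]
      simp
    have h2 : K.d₂ (ComplexShape.up ℕ) 0 q (q + 1) =
        (K.X 0).d q (q + 1) ≫
          K.ιTotal (ComplexShape.up ℕ) 0 (q + 1) (q + 1) (zero_add (q + 1)) := by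
      rw [K.d₂_eq (ComplexShape.up ℕ) 0 (i₂' := q + 1) rfl (q + 1) (zero_add (q + 1))]
      simp
    have h3 : f.f q ≫ (K.d 0 1).f q = 0 := by
      rw [← HomologicalComplex.comp_f, hf, HomologicalComplex.zero_f]
    rw [HomologicalComplex₂.total_d, Category.assoc, Preadditive.comp_add,
      HomologicalComplex₂.ι_D₁, HomologicalComplex₂.ι_D₂, h1, h2, Preadditive.comp_add,
      reassoc_of% h3, zero_comp, zero_add, f.comm_assoc]

/-- A map from a complex to the row `q = 0` of a double complex which is killed by the vertical
differential gives a map to the total complex. -/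
def rowToTotal (f : ∀ p, A.X p ⟶ (K.X p).X 0)
    (hf : ∀ p, f p ≫ (K.d p (p + 1)).f 0 = A.d p (p + 1) ≫ f (p + 1))
    (hf' : ∀ p, f p ≫ (K.X p).d 0 1 = 0) : A ⟶ K.total (ComplexShape.up ℕ) where
  f p := f p ≫ K.ιTotal (ComplexShape.up ℕ) p 0 p (add_zero p)
  comm' p p' hp := by
    obtain rfl : p + 1 = p' := hp
    have h1 : K.d₁ (ComplexShape.up ℕ) p 0 (p + 1) =
        (K.d p (p + 1)).f 0 ≫
          K.ιTotal (ComplexShape.up ℕ) (p + 1) 0 (p + 1) (add_zero (p + 1)) := by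
      rw [K.d₁_eq (ComplexShape.up ℕ) (i₁' := p + 1) rfl 0 (p + 1) (add_zero (p + 1))]
      simp
    have h2 : f p ≫ K.d₂ (ComplexShape.up ℕ) p 0 (p + 1) = 0 := by
      rw [K.d₂_eq (ComplexShape.up ℕ) p (i₂' := 1) rfl (p + 1) rfl, Linear.comp_units_smul,
        reassoc_of% (hf' p), zero_comp, smul_zero]
    rw [HomologicalComplex₂.total_d, Category.assoc, Preadditive.comp_add,
      HomologicalComplex₂.ι_D₁, HomologicalComplex₂.ι_D₂, Preadditive.comp_add, h2, h1, add_zero,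
      reassoc_of% (hf p)]

end Edge

/-! ### The Godement resolution, sheaf cohomology and hypercohomology -/

section Godement

variable {R : Type} [Ring R] {X : TopCat.{u}}

/-- The global section functor `Γ(X, -)`. -/
def globalSections (R : Type) [Ring R] (X : TopCat.{u}) :
    TopCat.Sheaf (ModuleCat.{u} R) X ⥤ ModuleCat.{u} R :=
  TopCat.Sheaf.forget _ _ ⋙ (evaluation _ _).obj (op ⊤)

instance : (globalSections R X).Additive where
  map_add := rfl

/-- The functor `C⁰` on sheaves: `C⁰F(U) = ∏_{x ∈ U} F_x` is the module of all (continuous or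
discontinuous) sections over `U` of the étalé space of `F`. -/
def godementZero (R : Type) [Ring R] (X : TopCat.{u}) :
    TopCat.Sheaf (ModuleCat.{u} R) X ⥤ TopCat.Sheaf (ModuleCat.{u} R) X where
  obj F := (FunctionSheaf.all.{u, u} R (fun x : X => F.presheaf.stalk x)).sheaf
  map {F G} φ := FunctionSheaf.homMk
    (fun U =>
      { toFun := fun f =>
          ⟨fun x => ((TopCat.Presheaf.stalkFunctor (ModuleCat.{u} R) x.1).map φ.hom).hom (f.1 x),
            Submodule.mem_top⟩
        map_add' := fun f g => Subtype.ext (funext fun x => map_add _ _ _)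
        map_smul' := fun c f => Subtype.ext (funext fun x => map_smul _ _ _) })
    (fun _ _ _ _ _ => rfl)
  map_id F := by
    apply ObjectProperty.hom_ext
    ext U f
    apply Subtype.ext
    funext x
    have : (𝟙 F : F ⟶ F).hom = 𝟙 F.presheaf := rfl
    change ((TopCat.Presheaf.stalkFunctor (ModuleCat.{u} R) x.1).map (𝟙 F.presheaf)).hom (f.1 x) = _
    rw [CategoryTheory.Functor.map_id]
    rfl
  map_comp {F G H} φ ψ := by
    apply ObjectProperty.hom_ext
    ext U f
    apply Subtype.ext
    funext x
    change ((TopCat.Presheaf.stalkFunctor (ModuleCat.{u} R) x.1).map (φ.hom ≫ ψ.hom)).hom (f.1 x) = _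
    rw [CategoryTheory.Functor.map_comp]
    rfl

instance : (godementZero R X).Additive where
  map_add {F G φ ψ} := by
    apply ObjectProperty.hom_ext
    ext U f
    apply Subtype.ext
    funext x
    change ((TopCat.Presheaf.stalkFunctor (ModuleCat.{u} R) x.1).map (φ.hom + ψ.hom)).hom (f.1 x) = _
    rw [CategoryTheory.Functor.map_add]
    rfl

/-- The inclusion `F → C⁰F`, which sends a section to the family of its germs. -/
def toGodementZero (F : TopCat.Sheaf (ModuleCat.{u} R) X) : F ⟶ (godementZero R X).obj F :=
  ObjectProperty.homMk
    { app := fun U => ModuleCat.ofHom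
        { toFun := fun s => ⟨fun x => (F.presheaf.germ U.unop x.1 x.2).hom s, Submodule.mem_top⟩
          map_add' := fun s t => Subtype.ext (funext fun x => map_add _ _ _)
          map_smul' := fun c s => Subtype.ext (funext fun x => map_smul _ _ _) }
      naturality := fun U W i => by
        ext s
        apply Subtype.ext
        funext x
        exact TopCat.Presheaf.germ_res_apply F.presheaf i.unop x.1 x.2 s }

theorem toGodementZero_naturality {F G : TopCat.Sheaf (ModuleCat.{u} R) X} (φ : F ⟶ G) :
    toGodementZero F ≫ (godementZero R X).map φ = φ ≫ toGodementZero G := by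
  apply ObjectProperty.hom_ext
  ext U s
  apply Subtype.ext
  funext x
  exact TopCat.Presheaf.stalkFunctor_map_germ_apply U.unop x.1 x.2 φ.hom s

/-- The functor `F ↦ Q¹ = C⁰F / F` (quotient sheaf). -/
def godementQuotient (R : Type) [Ring R] (X : TopCat.{u}) :
    TopCat.Sheaf (ModuleCat.{u} R) X ⥤ TopCat.Sheaf (ModuleCat.{u} R) X where
  obj F := cokernel (toGodementZero F)
  map {F G} φ := cokernel.map _ _ φ ((godementZero R X).map φ) (toGodementZero_naturality φ)
  map_id F := by
    rw [← cancel_epi (cokernel.π (toGodementZero F))]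
    simp
  map_comp {F G H} φ ψ := by
    rw [← cancel_epi (cokernel.π (toGodementZero F))]
    simp

/-- The projection `C⁰F → Q¹`. -/
def toGodementQuotient (F : TopCat.Sheaf (ModuleCat.{u} R) X) :
    (godementZero R X).obj F ⟶ (godementQuotient R X).obj F :=
  cokernel.π (toGodementZero F)

theorem toGodementQuotient_naturality {F G : TopCat.Sheaf (ModuleCat.{u} R) X} (φ : F ⟶ G) :
    toGodementQuotient F ≫ (godementQuotient R X).map φ =
      (godementZero R X).map φ ≫ toGodementQuotient G :=
  cokernel.π_desc _ _ _

@[simp]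
theorem toGodementZero_toGodementQuotient (F : TopCat.Sheaf (ModuleCat.{u} R) X) :
    toGodementZero F ≫ toGodementQuotient F = 0 :=
  cokernel.condition _

instance toGodementQuotient_epi (F : TopCat.Sheaf (ModuleCat.{u} R) X) :
    Epi (toGodementQuotient F) :=
  inferInstanceAs (Epi (cokernel.π (toGodementZero F)))

instance godementQuotient_additive : (godementQuotient R X).Additive where
  map_add {F G φ ψ} := by
    rw [← cancel_epi (toGodementQuotient F), Preadditive.comp_add]
    rw [toGodementQuotient_naturality, toGodementQuotient_naturality,
      toGodementQuotient_naturality, (godementZero R X).map_add, Preadditive.add_comp]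

/-- The functors `F ↦ Qᵖ`, where `Q⁰ = F` and `Qᵖ⁺¹ = C⁰Qᵖ / Qᵖ`. -/
def godementQ (R : Type) [Ring R] (X : TopCat.{u}) :
    ℕ → (TopCat.Sheaf (ModuleCat.{u} R) X ⥤ TopCat.Sheaf (ModuleCat.{u} R) X)
  | 0 => 𝟭 _
  | p + 1 => godementQ R X p ⋙ godementQuotient R X

instance godementQ_additive (p : ℕ) : (godementQ R X p).Additive := by
  induction p with
  | zero => exact ⟨fun {_ _ _ _} => rfl⟩
  | succ p ih => 
    refine ⟨fun {F G φ ψ} => ?_⟩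
    change (godementQuotient R X).map ((godementQ R X p).map (φ + ψ)) = 
     (godementQuotient R X).map ((godementQ R X p).map φ) + 
     (godementQuotient R X).map ((godementQ R X p).map ψ)
    rw [Functor.map_add, Functor.map_add]

/-- The Godement functors `Cᵖ = C⁰Qᵖ`. -/
def godement (R : Type) [Ring R] (X : TopCat.{u}) (p : ℕ) :
    TopCat.Sheaf (ModuleCat.{u} R) X ⥤ TopCat.Sheaf (ModuleCat.{u} R) X :=
  godementQ R X p ⋙ godementZero R X

instance godement_additive (p : ℕ) : (godement R X p).Additive where
  map_add {F G φ ψ} := by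
    change (godementZero R X).map ((godementQ R X p).map (φ + ψ)) = 
     (godementZero R X).map ((godementQ R X p).map φ) + 
     (godementZero R X).map ((godementQ R X p).map ψ)
    rw [Functor.map_add, Functor.map_add]

/-- The differential `δ : C⁰F → C¹F`, the composite `C⁰F → Q¹ → C⁰Q¹`. -/
def godementδZero (F : TopCat.Sheaf (ModuleCat.{u} R) X) :
    (godementZero R X).obj F ⟶ (godementZero R X).obj ((godementQuotient R X).obj F) :=
  toGodementQuotient F ≫ toGodementZero ((godementQuotient R X).obj F)

theorem toGodementZero_godementδZero (F : TopCat.Sheaf (ModuleCat.{u} R) X) :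
    toGodementZero F ≫ godementδZero F = 0 := by
  rw [godementδZero, ← Category.assoc, toGodementZero_toGodementQuotient, zero_comp]

theorem godementδZero_comp (F : TopCat.Sheaf (ModuleCat.{u} R) X) :
    godementδZero F ≫ godementδZero ((godementQuotient R X).obj F) = 0 := by
  rw [godementδZero, Category.assoc, toGodementZero_godementδZero, comp_zero]

theorem godementδZero_naturality {F G : TopCat.Sheaf (ModuleCat.{u} R) X} (φ : F ⟶ G) :
    (godementZero R X).map φ ≫ godementδZero G =
      godementδZero F ≫ (godementZero R X).map ((godementQuotient R X).map φ) := by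
  rw [godementδZero, godementδZero, Category.assoc, toGodementZero_naturality,
    ← Category.assoc, ← Category.assoc, toGodementQuotient_naturality]

/-- The differentials `δ : Cᵖ → Cᵖ⁺¹` of the Godement resolution, the composites
`C⁰Qᵖ → Qᵖ⁺¹ → C⁰Qᵖ⁺¹`. -/
def godementδ (R : Type) [Ring R] (X : TopCat.{u}) (p : ℕ) :
    godement R X p ⟶ godement R X (p + 1) where
  app F := godementδZero ((godementQ R X p).obj F)
  naturality _ _ φ := godementδZero_naturality ((godementQ R X p).map φ)

theorem godementδ_comp (p : ℕ) (F : TopCat.Sheaf (ModuleCat.{u} R) X) :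
    (godementδ R X p).app F ≫ (godementδ R X (p + 1)).app F = 0 :=
  godementδZero_comp ((godementQ R X p).obj F)

/-- The complex `C⁰F → C¹F → C²F → ⋯` of sheaves (the Godement canonical resolution of `F`). -/
def godementComplex (F : TopCat.Sheaf (ModuleCat.{u} R) X) :
    CochainComplex (TopCat.Sheaf (ModuleCat.{u} R) X) ℕ :=
  CochainComplex.of (fun p => (godement R X p).obj F) (fun p => (godementδ R X p).app F)
    (fun p => godementδ_comp p F)

/-- The complex `C⁰F(X) → C¹F(X) → C²F(X) → ⋯` of global sections of the Godement resolution. -/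
def godementSections (F : TopCat.Sheaf (ModuleCat.{u} R) X) : CochainComplex (ModuleCat.{u} R) ℕ :=
  ((globalSections R X).mapHomologicalComplex _).obj (godementComplex F)

/-- The sheaf cohomology `Hᵏ(X, F)`. -/
def sheafCohomology (F : TopCat.Sheaf (ModuleCat.{u} R) X) (k : ℕ) : ModuleCat.{u} R :=
  (godementSections F).homology k

/-- The functors `Γ(X, Cᵖ -)`. -/
def godementΓ (R : Type) [Ring R] (X : TopCat.{u}) (p : ℕ) :
    TopCat.Sheaf (ModuleCat.{u} R) X ⥤ ModuleCat.{u} R :=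
  godement R X p ⋙ globalSections R X

instance godementΓ_additive (p : ℕ) : (godementΓ R X p).Additive :=
  inferInstanceAs (godement R X p ⋙ globalSections R X).Additive

/-- The maps `δ : Γ(X, Cᵖ -) → Γ(X, Cᵖ⁺¹ -)`. -/
def godementΓδ (R : Type) [Ring R] (X : TopCat.{u}) (p : ℕ) :
    godementΓ R X p ⟶ godementΓ R X (p + 1) :=
  Functor.whiskerRight (godementδ R X p) (globalSections R X)

theorem godementΓδ_comp (p : ℕ) (F : TopCat.Sheaf (ModuleCat.{u} R) X) :
    (godementΓδ R X p).app F ≫ (godementΓδ R X (p + 1)).app F = 0 := by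
  have := congrArg (globalSections R X).map (godementδ_comp p F)
  rwa [Functor.map_comp, Functor.map_zero] at this

/-- The double complex `K^{p,q} = Γ(X, Cᵖ L^q)` of a complex of sheaves `L`. The first index is `p`,
in the direction of `δ`; the second index is `q`, in the direction of the differential of `L`. -/
def doubleComplex (L : CochainComplex (TopCat.Sheaf (ModuleCat.{u} R) X) ℕ) :
    HomologicalComplex₂ (ModuleCat.{u} R) (ComplexShape.up ℕ) (ComplexShape.up ℕ) :=
  CochainComplex.of
    (fun p => ((godementΓ R X p).mapHomologicalComplex (ComplexShape.up ℕ)).obj L)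
    (fun p => (NatTrans.mapHomologicalComplex (godementΓδ R X p) (ComplexShape.up ℕ)).app L)
    (fun p => by
      ext1 q
      exact godementΓδ_comp p (L.X q))

/-- The total complex, with differential `D = δ + (-1)^p d`, of the double complex
`Γ(X, Cᵖ L^q)`. -/
def hyperComplex (L : CochainComplex (TopCat.Sheaf (ModuleCat.{u} R) X) ℕ) :
    CochainComplex (ModuleCat.{u} R) ℕ :=
  (doubleComplex L).total (ComplexShape.up ℕ)

/-- The hypercohomology `ℍᵏ(X, L)` of a complex of sheaves `L`. -/
def hypercohomology (L : CochainComplex (TopCat.Sheaf (ModuleCat.{u} R) X) ℕ) (k : ℕ) :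
    ModuleCat.{u} R :=
  (hyperComplex L).homology k

theorem doubleComplex_d (L : CochainComplex (TopCat.Sheaf (ModuleCat.{u} R) X) ℕ) (p : ℕ) :
    (doubleComplex L).d p (p + 1) =
      (NatTrans.mapHomologicalComplex (godementΓδ R X p) (ComplexShape.up ℕ)).app L :=
  CochainComplex.of_d
    (fun p => ((godementΓ R X p).mapHomologicalComplex (ComplexShape.up ℕ)).obj L)
    (fun p => (NatTrans.mapHomologicalComplex (godementΓδ R X p) (ComplexShape.up ℕ)).app L) p

theorem godementSections_d (F : TopCat.Sheaf (ModuleCat.{u} R) X) (p : ℕ) :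
    (godementSections F).d p (p + 1) = (godementΓδ R X p).app F :=
  congrArg (globalSections R X).map (CochainComplex.of_d _ _ _)

theorem toGodementZero_godementΓδ (F : TopCat.Sheaf (ModuleCat.{u} R) X) :
    (globalSections R X).map (toGodementZero F) ≫ (godementΓδ R X 0).app F = 0 := by
  have := congrArg (globalSections R X).map (toGodementZero_godementδZero F)
  rwa [Functor.map_comp, Functor.map_zero] at this

/-- The complex `L⁰(X) → L¹(X) → ⋯` of global sections of a complex of sheaves. -/
def sectionsComplex (L : CochainComplex (TopCat.Sheaf (ModuleCat.{u} R) X) ℕ) :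
    CochainComplex (ModuleCat.{u} R) ℕ :=
  ((globalSections R X).mapHomologicalComplex _).obj L

/-- The inclusions `L^q(X) → C⁰L^q(X)` of the global sections of the sheaves `L^q` into the column
`p = 0` of the double complex. -/
def sectionsToColumn (L : CochainComplex (TopCat.Sheaf (ModuleCat.{u} R) X) ℕ) :
    sectionsComplex L ⟶ (doubleComplex L).X 0 where
  f q := (globalSections R X).map (toGodementZero (L.X q))
  comm' q q' _ := by
    have := congrArg (globalSections R X).map (toGodementZero_naturality (L.d q q'))
    rw [Functor.map_comp, Functor.map_comp] at this
    exact this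

/-- The map of complexes `L^•(X) → ⨁ Γ(X, Cᵖ L^q)` given by the inclusions `L^q(X) → C⁰L^q(X)`. -/
def sectionsToHyper (L : CochainComplex (TopCat.Sheaf (ModuleCat.{u} R) X) ℕ) :
    sectionsComplex L ⟶ hyperComplex L :=
  columnToTotal (doubleComplex L) (sectionsComplex L) (sectionsToColumn L) (by
    ext1 q
    rw [doubleComplex_d]
    exact toGodementZero_godementΓδ (L.X q))

/-- The map of complexes `C^•F(X) → ⨁ Γ(X, Cᵖ L^q)` given by the maps `CᵖF(X) → CᵖL⁰(X)` which are
induced by an augmentation `i : F → L⁰`. -/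
def godementToHyper {F : TopCat.Sheaf (ModuleCat.{u} R) X}
    (L : CochainComplex (TopCat.Sheaf (ModuleCat.{u} R) X) ℕ) (i : F ⟶ L.X 0)
    (hi : i ≫ L.d 0 1 = 0) :
    godementSections F ⟶ hyperComplex L :=
  rowToTotal (doubleComplex L) (godementSections F) (fun p => (godementΓ R X p).map i)
    (fun p => by
      rw [doubleComplex_d, godementSections_d]
      exact (godementΓδ R X p).naturality i)
    (fun p => by
      have := congrArg (godementΓ R X p).map hi
      rw [Functor.map_comp, Functor.map_zero] at this
      exact this)

end Godement

/-! ### Smooth differential forms -/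

theorem two_le_infty : (2 : WithTop ℕ∞) ≤ ∞ := by
  have h : ((2 : ℕ∞) : WithTop ℕ∞) ≤ ((⊤ : ℕ∞) : WithTop ℕ∞) := WithTop.coe_le_coe.2 le_top
  exact h

section Forms

variable {n : ℕ} {M : Type u} [TopologicalSpace M] [ChartedSpace (EuclideanSpace ℝ (Fin n)) M]

local notation "𝔼" => EuclideanSpace ℝ (Fin n)

/-- The space `⋀ᵏ T*_x M` of alternating `k`-linear forms on the tangent space of `M` at `x`. -/
abbrev AltForm (n : ℕ) (M : Type u) [TopologicalSpace M]
    [ChartedSpace (EuclideanSpace ℝ (Fin n)) M] (k : ℕ) (x : M) : Type :=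
  TangentSpace (𝓡 n) x [⋀^Fin k]→L[ℝ] ℝ

/-- The expression `(e⁻¹)^* α` of a form `α` on `U ⊆ M` in the chart `e`, extended by zero. It is a
form on the open subset `e(U)` of Euclidean space. -/
def chartForm {k : ℕ} (e : OpenPartialHomeomorph M 𝔼) {U : Opens M} (α : ∀ x : U, AltForm n M k x) :
    𝔼 → 𝔼 [⋀^Fin k]→L[ℝ] ℝ :=
  open Classical in fun y =>
    if h : e.symm y ∈ U then
      ContinuousAlternatingMap.compContinuousLinearMap (M := 𝔼) (M' := 𝔼) (α ⟨e.symm y, h⟩)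
        (mfderiv (𝓡 n) (𝓡 n) e.symm y)
    else 0

/-- The open set `e(U)`, the image of `U` (or rather of the part of `U` in the domain of `e`)
under the chart `e`. -/
def chartDomain (e : OpenPartialHomeomorph M 𝔼) (U : Opens M) : Set 𝔼 :=
  e.target ∩ e.symm ⁻¹' U

/-- A form on `U` is smooth if its expression in every chart of the atlas is smooth. -/
def IsSmoothForm {k : ℕ} {U : Opens M} (α : ∀ x : U, AltForm n M k x) : Prop :=
  ∀ e ∈ atlas 𝔼 M, ContDiffOn ℝ ∞ (chartForm e α) (chartDomain e U)

/-- The exterior derivative of a form on `U`: near `x` it is `φ^* d (φ⁻¹)^* α`, where `φ` is the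
preferred chart at `x` and the `d` in the middle is that of Euclidean space. -/
def dForm {k : ℕ} {U : Opens M} (α : ∀ x : U, AltForm n M k x) (x : U) : AltForm n M (k + 1) x :=
  ContinuousAlternatingMap.compContinuousLinearMap (M := 𝔼) (M' := 𝔼)
    (extDeriv (chartForm (chartAt 𝔼 x.1) α) (chartAt 𝔼 x.1 x.1))
    (mfderiv (𝓡 n) (𝓡 n) (chartAt 𝔼 x.1) x.1)

set_option linter.unusedSectionVars false in
theorem isOpen_chartDomain (e : OpenPartialHomeomorph M 𝔼) (U : Opens M) :
    IsOpen (chartDomain e U) :=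
  e.isOpen_inter_preimage_symm U.2

theorem chartForm_eq {k : ℕ} (e : OpenPartialHomeomorph M 𝔼) {U : Opens M}
    (α : ∀ x : U, AltForm n M k x) {y : 𝔼} {x : M} (hx : x ∈ U) (hxy : e.symm y = x) :
    chartForm e α y = (ContinuousAlternatingMap.compContinuousLinearMap (M := 𝔼) (M' := 𝔼) (α ⟨x, hx⟩)
        (mfderiv (𝓡 n) (𝓡 n) e.symm y) : 𝔼 [⋀^Fin k]→L[ℝ] ℝ) := by
  subst hxy
  exact dif_pos hx

theorem chartForm_restrict {k : ℕ} (e : OpenPartialHomeomorph M 𝔼) {U W : Opens M} (h : W ≤ U)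
    (α : ∀ x : U, AltForm n M k x) {y : 𝔼} (hy : e.symm y ∈ W) :
    chartForm e (fun x : W => α ⟨x, h x.2⟩) y = chartForm e α y := by
  rw [chartForm_eq e α (h hy) rfl, chartForm_eq e _ hy rfl]

theorem chartForm_add {k : ℕ} (e : OpenPartialHomeomorph M 𝔼) {U : Opens M}
    (α β : ∀ x : U, AltForm n M k x) : chartForm e (α + β) = chartForm e α + chartForm e β := by
  funext y
  by_cases h : e.symm y ∈ U
  · rw [Pi.add_apply, chartForm_eq e _ h rfl, chartForm_eq e _ h rfl, chartForm_eq e _ h rfl]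
    rfl
  · simp [chartForm, h]

theorem chartForm_smul {k : ℕ} (e : OpenPartialHomeomorph M 𝔼) {U : Opens M} (c : ℝ)
    (α : ∀ x : U, AltForm n M k x) : chartForm e (c • α) = c • chartForm e α := by
  funext y
  by_cases h : e.symm y ∈ U
  · rw [Pi.smul_apply, chartForm_eq e _ h rfl, chartForm_eq e _ h rfl]
    rfl
  · simp [chartForm, h]

theorem IsSmoothForm.restrict {k : ℕ} {U W : Opens M} (h : W ≤ U) {α : ∀ x : U, AltForm n M k x}
    (hα : IsSmoothForm α) : IsSmoothForm (fun x : W => α ⟨x, h x.2⟩) := fun e he =>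
  ((hα e he).mono (fun _ hy => ⟨hy.1, h hy.2⟩)).congr fun _ hy => chartForm_restrict e h α hy.2

theorem IsSmoothForm.contDiffAt {k : ℕ} {U : Opens M} {α : ∀ x : U, AltForm n M k x}
    (hα : IsSmoothForm α) {e : OpenPartialHomeomorph M 𝔼} (he : e ∈ atlas 𝔼 M) {y : 𝔼}
    (hy : y ∈ chartDomain e U) : ContDiffAt ℝ ∞ (chartForm e α) y :=
  (hα e he).contDiffAt ((isOpen_chartDomain e U).mem_nhds hy)

variable (n M) in
/-- The smooth forms of degree `k` on the open subsets of `M`. -/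
def smoothForms (k : ℕ) : FunctionSheaf.{u, 0} ℝ (TopCat.of M) (fun x : M => AltForm n M k x) where
  carrier U :=
    { carrier := {α | IsSmoothForm (n := n) (M := M) (U := U) α}
      add_mem' := fun {α β} hα hβ e he => by
        rw [chartForm_add]
        exact (hα e he).add (hβ e he)
      zero_mem' := fun e he => by
        have : chartForm (n := n) (M := M) (U := U) e (0 : ∀ x : U, AltForm n M k x.1) = 0 := by
          simpa using chartForm_smul (n := n) (M := M) (U := U) (k := k) e 0 0
        rw [this]
        exact contDiffOn_const
      smul_mem' := fun c α hα e he => by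
        rw [chartForm_smul]
        exact (hα e he).const_smul c }
  restrict_mem h _ hf := IsSmoothForm.restrict (n := n) (M := M) h hf
  local_mem U f hf := by
    intro e he y hy
    obtain ⟨W, hWU, hW, hf⟩ := hf ⟨e.symm y, hy.2⟩
    have hyW : y ∈ chartDomain (n := n) (M := M) e W := ⟨hy.1, hW⟩
    refine ContDiffAt.contDiffWithinAt ?_
    refine (IsSmoothForm.contDiffAt (n := n) (M := M) hf he hyW).congr_of_eventuallyEq ?_
    filter_upwards [(isOpen_chartDomain (n := n) (M := M) e W).mem_nhds hyW] with z hz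
    exact (chartForm_restrict (n := n) (M := M) e hWU f hz.2).symm

theorem mem_chartDomain_chartAt {U : Opens M} (x : U) :
    chartAt 𝔼 x.1 x.1 ∈ chartDomain (chartAt 𝔼 x.1) U :=
  ⟨mem_chart_target _ _, by
    change (chartAt 𝔼 x.1).symm (chartAt 𝔼 x.1 x.1) ∈ U
    rw [(chartAt 𝔼 x.1).left_inv (mem_chart_source _ _)]
    exact x.2⟩

theorem dForm_smul {k : ℕ} {U : Opens M} (c : ℝ) (α : ∀ x : U, AltForm n M k x) :
    dForm (c • α) = c • dForm α := by
  funext x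
  rw [dForm, chartForm_smul, extDeriv_smul]
  rfl

theorem dForm_restrict {k : ℕ} {U W : Opens M} (h : W ≤ U) (α : ∀ x : U, AltForm n M k x) (x : W) :
    dForm (fun y : W => α ⟨y, h y.2⟩) x = dForm α ⟨x, h x.2⟩ := by
  have hx := mem_chartDomain_chartAt (n := n) x
  have hev : chartForm (chartAt 𝔼 x.1) (fun y : W => α ⟨y, h y.2⟩) =ᶠ[𝓝 (chartAt 𝔼 x.1 x.1)]
      chartForm (chartAt 𝔼 x.1) α := by
    filter_upwards [(isOpen_chartDomain (chartAt 𝔼 x.1) W).mem_nhds hx] with z hz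
    exact chartForm_restrict _ h α hz.2
  rw [dForm, hev.extDeriv_eq]
  rfl

section Smooth

variable [IsManifold (𝓡 n) ∞ M]

theorem contMDiffAt_chart {e : OpenPartialHomeomorph M 𝔼} (he : e ∈ atlas 𝔼 M) {x : M}
    (hx : x ∈ e.source) : ContMDiffAt (𝓡 n) (𝓡 n) ∞ e x :=
  contMDiffAt_of_mem_maximalAtlas (IsManifold.subset_maximalAtlas he) hx

theorem contMDiffAt_chart_symm {e : OpenPartialHomeomorph M 𝔼} (he : e ∈ atlas 𝔼 M) {y : 𝔼}
    (hy : y ∈ e.target) : ContMDiffAt (𝓡 n) (𝓡 n) ∞ e.symm y :=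
  contMDiffAt_symm_of_mem_maximalAtlas (IsManifold.subset_maximalAtlas he) hy

theorem contDiffAt_transition {e e' : OpenPartialHomeomorph M 𝔼} (he : e ∈ atlas 𝔼 M)
    (he' : e' ∈ atlas 𝔼 M) {y : 𝔼} (hy : y ∈ e.target) (hy' : e.symm y ∈ e'.source) :
    ContDiffAt ℝ ∞ (e' ∘ e.symm) y :=
  ((contMDiffAt_chart he' hy').comp y (contMDiffAt_chart_symm he hy)).contDiffAt

theorem fderiv_transition {e e' : OpenPartialHomeomorph M 𝔼} (he : e ∈ atlas 𝔼 M)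
    (he' : e' ∈ atlas 𝔼 M) {y : 𝔼} (hy : y ∈ e.target) (hy' : e.symm y ∈ e'.source) :
    fderiv ℝ (e' ∘ e.symm) y =
      (mfderiv (𝓡 n) (𝓡 n) e' (e.symm y)).comp (mfderiv (𝓡 n) (𝓡 n) e.symm y) := by
  rw [← mfderiv_eq_fderiv]
  exact mfderiv_comp y ((contMDiffAt_chart he' hy').mdifferentiableAt (by simp))
    ((contMDiffAt_chart_symm he hy).mdifferentiableAt (by simp))

theorem mfderiv_chart_symm_comp {e : OpenPartialHomeomorph M 𝔼} (he : e ∈ atlas 𝔼 M) {x : M}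
    (hx : x ∈ e.source) :
    (mfderiv (𝓡 n) (𝓡 n) e.symm (e x)).comp (mfderiv (𝓡 n) (𝓡 n) e x) =
      ContinuousLinearMap.id ℝ (TangentSpace (𝓡 n) x) :=
  (mdifferentiable_of_mem_atlas (I := 𝓡 n) he).symm_comp_deriv hx

/-- The expressions of a form in two charts are related by the transition map. -/
theorem chartForm_transition {k : ℕ} {U : Opens M} (α : ∀ x : U, AltForm n M k x)
    {e e' : OpenPartialHomeomorph M 𝔼} (he : e ∈ atlas 𝔼 M) (he' : e' ∈ atlas 𝔼 M) {y : 𝔼}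
    (hy : y ∈ chartDomain e U) (hy' : e.symm y ∈ e'.source) :
    chartForm e α y =
      (chartForm e' α ((e' ∘ e.symm) y)).compContinuousLinearMap (fderiv ℝ (e' ∘ e.symm) y) := by
  have hx : e'.symm ((e' ∘ e.symm) y) = e.symm y := e'.left_inv hy'
  rw [chartForm_eq e α hy.2 rfl, chartForm_eq e' α hy.2 hx, fderiv_transition he he' hy.1 hy']
  have key := mfderiv_chart_symm_comp he' hy'
  ext v
  have hv : ∀ w : 𝔼, (mfderiv (𝓡 n) (𝓡 n) e'.symm (e' (e.symm y)) : 𝔼 →L[ℝ] 𝔼)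
      ((mfderiv (𝓡 n) (𝓡 n) e' (e.symm y) : 𝔼 →L[ℝ] 𝔼) w) = w :=
    fun w => congrArg (fun L : 𝔼 →L[ℝ] 𝔼 => L w) key
  refine congrArg (fun w : Fin k → 𝔼 => (α ⟨e.symm y, hy.2⟩ : 𝔼 [⋀^Fin k]→L[ℝ] ℝ) w) ?_
  funext i
  exact (hv _).symm

/-- The expression of `dα` in a chart is the exterior derivative of the expression of `α`. -/
theorem chartForm_dForm {k : ℕ} {U : Opens M} {α : ∀ x : U, AltForm n M k x} (hα : IsSmoothForm α)
    {e : OpenPartialHomeomorph M 𝔼} (he : e ∈ atlas 𝔼 M) {y : 𝔼} (hy : y ∈ chartDomain e U) :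
    chartForm e (dForm α) y = extDeriv (chartForm e α) y := by
  have he' : chartAt 𝔼 (e.symm y) ∈ atlas 𝔼 M := chart_mem_atlas _ _
  have hy' : e.symm y ∈ (chartAt 𝔼 (e.symm y)).source := mem_chart_source _ _
  set e' := chartAt 𝔼 (e.symm y) with he'def
  have hz : (e' ∘ e.symm) y ∈ chartDomain e' U :=
    ⟨e'.map_source hy', by
      change e'.symm (e' (e.symm y)) ∈ U
      rw [e'.left_inv hy']
      exact hy.2⟩
  have hpull := extDeriv_pullback (r := ∞) (f := e' ∘ e.symm) (x := y)
    ((hα.contDiffAt he' hz).differentiableAt (by simp))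
    (contDiffAt_transition he he' hy.1 hy') (by simpa using two_le_infty)
  have hev : chartForm e α =ᶠ[𝓝 y] fun y =>
      (chartForm e' α ((e' ∘ e.symm) y)).compContinuousLinearMap (fderiv ℝ (e' ∘ e.symm) y) := by
    have h1 := (isOpen_chartDomain e U).mem_nhds hy
    have h2 : e.symm ⁻¹' e'.source ∈ 𝓝 y :=
      (e.symm.continuousAt hy.1).preimage_mem_nhds (e'.open_source.mem_nhds hy')
    filter_upwards [h1, h2] with z hz1 hz2
    exact chartForm_transition α he he' hz1 hz2
  rw [hev.extDeriv_eq, hpull, fderiv_transition he he' hy.1 hy', chartForm_eq e _ hy.2 rfl]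
  rfl

theorem IsSmoothForm.dForm {k : ℕ} {U : Opens M} {α : ∀ x : U, AltForm n M k x}
    (hα : IsSmoothForm α) : IsSmoothForm (dForm α) := by
  intro e he
  refine ContDiffOn.congr ?_ fun y hy => chartForm_dForm hα he hy
  intro y hy
  refine ContDiffAt.contDiffWithinAt ?_
  have h := (hα.contDiffAt he hy).fderiv_right (m := ∞) (by simp)
  exact (ContinuousAlternatingMap.alternatizeUncurryFinCLM ℝ 𝔼 ℝ).contDiff.contDiffAt.comp y h

set_option linter.unusedSectionVars false in
theorem dForm_add {k : ℕ} {U : Opens M} {α β : ∀ x : U, AltForm n M k x} (hα : IsSmoothForm α)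
    (hβ : IsSmoothForm β) : dForm (α + β) = dForm α + dForm β := by
  funext x
  have hx := mem_chartDomain_chartAt (n := n) x
  have hc := chart_mem_atlas 𝔼 x.1
  rw [dForm, chartForm_add, extDeriv_add ((hα.contDiffAt hc hx).differentiableAt (by simp))
    ((hβ.contDiffAt hc hx).differentiableAt (by simp))]
  rfl

theorem dForm_dForm {k : ℕ} {U : Opens M} {α : ∀ x : U, AltForm n M k x} (hα : IsSmoothForm α) :
    dForm (dForm α) = 0 := by
  funext x
  have hx := mem_chartDomain_chartAt (n := n) x
  have hc := chart_mem_atlas 𝔼 x.1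
  have hev : chartForm (chartAt 𝔼 x.1) (dForm α) =ᶠ[𝓝 (chartAt 𝔼 x.1 x.1)]
      extDeriv (chartForm (chartAt 𝔼 x.1) α) := by
    filter_upwards [(isOpen_chartDomain (chartAt 𝔼 x.1) U).mem_nhds hx] with z hz
    exact chartForm_dForm hα hc hz
  rw [dForm, hev.extDeriv_eq, extDeriv_extDeriv_apply (r := ∞) (hα.contDiffAt hc hx)
    (by simpa using two_le_infty)]
  rfl

/-! ### The de Rham complex -/

variable (n M) in
/-- The sheaf `𝒜ᵏ` of smooth `k`-forms on `M`. -/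
def formSheaf (k : ℕ) : TopCat.Sheaf (ModuleCat.{u} ℝ) (TopCat.of M) :=
  (smoothForms n M k).sheaf

variable (n M) in
/-- The exterior derivative `d : 𝒜ᵏ → 𝒜ᵏ⁺¹`. -/
def formSheafD (k : ℕ) : formSheaf n M k ⟶ formSheaf n M (k + 1) :=
  FunctionSheaf.homMk (S := smoothForms n M k) (S' := smoothForms n M (k + 1))
    (fun U =>
      { toFun := fun α => ⟨dForm (n := n) (M := M) (U := U) α.1,
          IsSmoothForm.dForm (n := n) (M := M) (U := U) α.2⟩
        map_add' := fun α β => Subtype.ext (dForm_add (n := n) (M := M) (U := U) α.2 β.2)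
        map_smul' := fun c α => Subtype.ext (dForm_smul (n := n) (M := M) (U := U) c α.1) })
    (fun _ _ h α x => dForm_restrict (n := n) (M := M) h α.1 x)

variable (n M) in
theorem formSheafD_comp (k : ℕ) : formSheafD n M k ≫ formSheafD n M (k + 1) = 0 := by
  apply ObjectProperty.hom_ext
  ext U α
  apply Subtype.ext
  exact dForm_dForm (n := n) (M := M) (U := U.unop) α.2

variable (n M) in
/-- The de Rham complex of sheaves `𝒜⁰ → 𝒜¹ → 𝒜² → ⋯` on `M`. -/
def deRhamComplex : CochainComplex (TopCat.Sheaf (ModuleCat.{u} ℝ) (TopCat.of M)) ℕ :=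
  CochainComplex.of (formSheaf n M) (formSheafD n M) (formSheafD_comp n M)

variable (n M) in
/-- The de Rham cohomology `H_dRᵏ(M)`, the cohomology of the complex
`𝒜⁰(M) → 𝒜¹(M) → 𝒜²(M) → ⋯` of global smooth forms. -/
def deRhamCohomology (k : ℕ) : ModuleCat.{u} ℝ :=
  (sectionsComplex (deRhamComplex n M)).homology k

end Smooth

/-! ### The sheaf of locally constant functions -/

/-- The locally constant real functions on the open subsets of a space. -/
def locallyConstantFunctions (X : TopCat.{u}) : FunctionSheaf.{u, 0} ℝ X (fun _ => ℝ) where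
  carrier U :=
    { carrier := {f | IsLocallyConstant f}
      add_mem' := fun hf hg => IsLocallyConstant.add hf hg
      zero_mem' := IsLocallyConstant.const 0
      smul_mem' := fun c f hf => hf.comp (c * ·) }
  restrict_mem h _ hf := hf.comp_continuous (continuous_inclusion h)
  local_mem U f hf := by
    refine (IsLocallyConstant.iff_eventually_eq f).2 fun x => ?_
    obtain ⟨W, hWU, hW, hf⟩ := hf x
    have h1 := (IsLocallyConstant.iff_eventually_eq _).1 hf ⟨x.1, hW⟩
    rw [nhds_subtype_eq_comap, Filter.eventually_comap] at h1 ⊢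
    filter_upwards [h1, W.2.mem_nhds hW] with z hz hzW a ha
    subst ha
    exact hz ⟨a.1, hzW⟩ rfl

/-- The sheaf `ℝ` of locally constant real functions on a space. -/
def realSheaf (X : TopCat.{u}) : TopCat.Sheaf (ModuleCat.{u} ℝ) X :=
  (locallyConstantFunctions X).sheaf

section Augmentation

/-- A function, regarded as a form of degree zero. -/
def zeroForm {U : Opens M} (f : U → ℝ) (x : U) : AltForm n M 0 x :=
  ContinuousAlternatingMap.constOfIsEmpty ℝ (TangentSpace (𝓡 n) x.1) (Fin 0) (f x)

theorem chartForm_zeroForm {U : Opens M} {f : U → ℝ} (hf : IsLocallyConstant f)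
    {e : OpenPartialHomeomorph M 𝔼} {y : 𝔼} (hy : y ∈ chartDomain e U) :
    chartForm e (zeroForm (n := n) f) =ᶠ[𝓝 y] fun _ =>
      ContinuousAlternatingMap.constOfIsEmpty ℝ 𝔼 (Fin 0) (f ⟨e.symm y, hy.2⟩) := by
  have h1 := (IsLocallyConstant.iff_eventually_eq f).1 hf ⟨e.symm y, hy.2⟩
  rw [nhds_subtype_eq_comap, Filter.eventually_comap] at h1
  filter_upwards [(e.symm.continuousAt hy.1).eventually h1,
    (isOpen_chartDomain e U).mem_nhds hy] with z hz hz'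
  rw [chartForm_eq e _ hz'.2 rfl, zeroForm, hz ⟨e.symm z, hz'.2⟩ rfl]
  rfl

theorem isSmoothForm_zeroForm {U : Opens M} {f : U → ℝ} (hf : IsLocallyConstant f) :
    IsSmoothForm (zeroForm (n := n) f) := fun _ _ _ hy =>
  (contDiffAt_const.congr_of_eventuallyEq (chartForm_zeroForm hf hy)).contDiffWithinAt

variable (n M) in
/-- The inclusion of the sheaf of locally constant functions into `𝒜⁰`. -/
def realToForm : realSheaf (TopCat.of M) ⟶ formSheaf n M 0 :=
  FunctionSheaf.homMk (S := locallyConstantFunctions (TopCat.of M)) (S' := smoothForms n M 0)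
    (fun U =>
      { toFun := fun f => ⟨zeroForm (n := n) (M := M) (U := U) f.1,
          isSmoothForm_zeroForm (n := n) (M := M) (U := U) f.2⟩
        map_add' := fun _ _ => rfl
        map_smul' := fun _ _ => rfl })
    (fun _ _ _ _ _ => rfl)

variable [IsManifold (𝓡 n) ∞ M]

variable (n M) in
theorem realToForm_d : realToForm n M ≫ (deRhamComplex n M).d 0 1 = 0 := by
  have h : (deRhamComplex n M).d 0 1 = formSheafD n M 0 :=
    CochainComplex.of_d (formSheaf n M) (formSheafD n M) 0
  rw [h]
  apply ObjectProperty.hom_ext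
  ext U f
  apply Subtype.ext
  funext x
  have hx := mem_chartDomain_chartAt (n := n) (M := M) (U := U.unop) x
  have h1 := chartForm_zeroForm (n := n) (M := M) (U := U.unop) (f := f.1) f.2 hx
  change dForm (n := n) (M := M) (U := U.unop) (zeroForm (n := n) (M := M) (U := U.unop) f.1) x = 0
  rw [dForm, h1.extDeriv_eq, extDeriv_constOfIsEmpty]
  simp
  rfl

variable (n M) in
/-- The map of complexes `C^•ℝ(M) → ⨁ Γ(M, Cᵖ𝒜^q)` induced by the inclusion `ℝ → 𝒜⁰`. -/
def realToHyper : godementSections (realSheaf (TopCat.of M)) ⟶ hyperComplex (deRhamComplex n M) :=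
  godementToHyper (deRhamComplex n M) (realToForm n M) (realToForm_d n M)

variable (n M) in
/-- The map `Hᵏ(M, ℝ) → ℍᵏ(M, 𝒜^•)` induced by the inclusion `ℝ → 𝒜⁰`. -/
def sheafToHypercohomology (k : ℕ) :
    sheafCohomology (realSheaf (TopCat.of M)) k ⟶ hypercohomology (deRhamComplex n M) k :=
  HomologicalComplex.homologyMap (realToHyper n M) k

variable (n M) in
/-- The map `H_dRᵏ(M) → ℍᵏ(M, 𝒜^•)` induced by the inclusions `𝒜^q(M) → C⁰𝒜^q(M)`. -/
def deRhamToHypercohomology (k : ℕ) :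
    deRhamCohomology n M k ⟶ hypercohomology (deRhamComplex n M) k :=
  HomologicalComplex.homologyMap (sectionsToHyper (deRhamComplex n M)) k

end Augmentation

end Forms

end DeRham

end

noncomputable section

namespace DeRham

/-! ### Elementwise criterion for quasi-isomorphisms of complexes of modules -/

section QuasiIso

variable {R : Type} [Ring R] {A B : CochainComplex (ModuleCat.{u} R) ℕ}

/-! Both canonical maps are edge maps into the total complex of `K^{p,q} = Γ(M, C^p A^q)`. An edge
map is a quasi-isomorphism as soon as the lines transverse to the edge are exact and resolve the
edge complex. In the first quadrant this is a finite zigzag: if the coboundary of a cochain lies on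
the edge, the component of the cochain farthest from the edge is closed in the transverse direction,
hence a boundary there, and subtracting the total coboundary of a preimage moves the cochain one
step towards the edge (`TotalData.exists_sub_D_concentrated`). The argument is made for one edge and
transferred to the other by `TotalData.swap`.

On the de Rham side `q` is fixed, and the line is the complex of global sections of the Godement
resolution of `A^q`. It is exact because `A^q` is fine: a smooth partition of unity, which exists
since `M` is Hausdorff and second countable, acts on `A^q` by multiplication and, by functoriality,
on every `Q^p`. It glues local lifts, so that `Γ(C⁰Q^p) → Γ(Q^{p+1})` is surjective
(`IsFine.toGodementQuotient_surjective`); left exactness of `Γ` does the rest.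

On the side of the constant sheaf `p` is fixed, and the line is the functor `Γ(M, C^p -)` applied to
`0 → ℝ → A⁰ → A¹ → ⋯`. This functor is exact (`godementΓ_exact`): a section of `C⁰F` is an arbitrary
family of germs, so lifting is done point by point, and `F ↦ C⁰F/F` is exact by the 3×3 lemma. The
sequence of sheaves is exact by the Poincaré lemma, proved in a chart with the radial homotopy
operator `w ↦ ∫₀¹ t^k ι_{x-c} w(c + t(x-c)) dt`. -/

theorem homologyπ_surjective (k : ℕ) : Function.Surjective (A.homologyπ k) :=
  (ModuleCat.epi_iff_surjective _).1 inferInstance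

theorem iCycles_injective (k : ℕ) : Function.Injective (A.iCycles k) :=
  (ModuleCat.mono_iff_injective _).1 inferInstance

theorem exists_cycle (k : ℕ) (a : A.X k) (ha : A.d k (k + 1) a = 0) :
    ∃ c : A.cycles k, A.iCycles k c = a := by
  let l := A.liftCycles (ModuleCat.ofHom
    (((LinearMap.ker (A.d k (k + 1)).hom).subtype))) (k + 1) (by simp) (by
      ext x
      exact x.2)
  refine ⟨l ⟨a, ha⟩, ?_⟩
  exact congrArg (fun φ => φ.hom ⟨a, ha⟩) (A.liftCycles_i (ModuleCat.ofHom
    (((LinearMap.ker (A.d k (k + 1)).hom).subtype))) (k + 1) (by simp) (by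
      ext x
      exact x.2))

theorem d_iCycles_apply (k : ℕ) (c : A.cycles k) : A.d k (k + 1) (A.iCycles k c) = 0 :=
  congrArg (fun φ => φ.hom c) (A.iCycles_d k (k + 1))

/-- Homology is the cokernel of the map from the preceding term to the cycles. The degree `j` is
left free so that `k = 0` needs no separate case: differentials between non-consecutive degrees
vanish, so there the right side says that the cycle is zero. -/
theorem homologyπ_eq_zero_iff (k : ℕ) (c : A.cycles k) :
    A.homologyπ k c = 0 ↔ ∃ (j : ℕ) (w : A.X j), A.iCycles k c = A.d j k w := by
  constructor
  · intro h
    have hex : (ShortComplex.mk (A.toCycles ((ComplexShape.up ℕ).prev k) k) (A.homologyπ k)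
        (by simp)).Exact :=
      ShortComplex.exact_of_g_is_cokernel _ (A.homologyIsCokernel _ _ rfl)
    obtain ⟨w, hw⟩ := (ShortComplex.moduleCat_exact_iff _).1 hex c h
    refine ⟨_, w, ?_⟩
    rw [← hw]
    exact congrArg (fun φ => φ.hom w) (A.toCycles_i ((ComplexShape.up ℕ).prev k) k)
  · rintro ⟨j, w, hw⟩
    have : c = A.toCycles j k w := iCycles_injective k (by
      rw [hw]
      exact (congrArg (fun φ => φ.hom w) (A.toCycles_i j k)).symm)
    rw [this]
    exact congrArg (fun φ => φ.hom w) (A.toCycles_comp_homologyπ j k)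

/-- A map of complexes of modules induces an isomorphism on cohomology if every cocycle of the
target is cohomologous to the image of a cocycle, and a cocycle whose image is a coboundary is
a coboundary. -/
theorem isIso_homologyMap_of_elements (f : A ⟶ B) (k : ℕ)
    (hsurj : ∀ z : B.X k, B.d k (k + 1) z = 0 →
      ∃ a : A.X k, A.d k (k + 1) a = 0 ∧ ∃ (j : ℕ) (w : B.X j), z - f.f k a = B.d j k w)
    (hinj : ∀ a : A.X k, A.d k (k + 1) a = 0 →
      (∃ (j : ℕ) (w : B.X j), f.f k a = B.d j k w) → ∃ (j : ℕ) (b : A.X j), a = A.d j k b) :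
    IsIso (HomologicalComplex.homologyMap f k) := by
  have hπ : ∀ c : A.cycles k, HomologicalComplex.homologyMap f k (A.homologyπ k c) =
      B.homologyπ k (HomologicalComplex.cyclesMap f k c) := fun c =>
    congrArg (fun φ => φ.hom c) (HomologicalComplex.homologyπ_naturality f k)
  have hi : ∀ c : A.cycles k, B.iCycles k (HomologicalComplex.cyclesMap f k c) =
      f.f k (A.iCycles k c) := fun c =>
    congrArg (fun φ => φ.hom c) (HomologicalComplex.cyclesMap_i f k)
  have : Mono (HomologicalComplex.homologyMap f k) := by
    rw [ModuleCat.mono_iff_injective, injective_iff_map_eq_zero]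
    intro x hx
    obtain ⟨c, rfl⟩ := homologyπ_surjective k x
    rw [hπ, homologyπ_eq_zero_iff, hi] at hx
    exact (homologyπ_eq_zero_iff k c).2 (hinj _ (d_iCycles_apply k c) hx)
  have : Epi (HomologicalComplex.homologyMap f k) := by
    rw [ModuleCat.epi_iff_surjective]
    intro y
    obtain ⟨c, rfl⟩ := homologyπ_surjective k y
    obtain ⟨a, ha, hw⟩ := hsurj _ (d_iCycles_apply k c)
    obtain ⟨c', rfl⟩ := exists_cycle k a ha
    refine ⟨A.homologyπ k c', ?_⟩
    rw [hπ]
    refine (sub_eq_zero.1 ?_).symm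
    rw [← map_sub, homologyπ_eq_zero_iff, map_sub, hi]
    exact hw
  exact isIso_of_mono_of_epi _

end QuasiIso

/-! ### The total complex of a first-quadrant double complex with exact lines -/

/-- The data of a first-quadrant double complex of abelian groups with anticommuting differentials
`h` and `v` and of its total complex, given by projections to and inclusions of the summands. -/
structure TotalData (K : ℕ → ℕ → Type u) [∀ p q, AddCommGroup (K p q)]
    (T : ℕ → Type u) [∀ k, AddCommGroup (T k)] where
  h (p q : ℕ) : K p q →+ K (p + 1) q
  v (p q : ℕ) : K p q →+ K p (q + 1)
  D (j k : ℕ) : T j →+ T k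
  π (p q k : ℕ) (hk : p + q = k) : T k →+ K p q
  ι (p q k : ℕ) (hk : p + q = k) : K p q →+ T k
  ext (k : ℕ) (z : T k) (hz : ∀ p q hk, π p q k hk z = 0) : z = 0
  π_ι_self (p q k : ℕ) (hk : p + q = k) (x : K p q) : π p q k hk (ι p q k hk x) = x
  π_ι_of_ne (p q p' q' k : ℕ) (hk : p + q = k) (hk' : p' + q' = k) (hp : p ≠ p') (x : K p q) :
    π p' q' k hk' (ι p q k hk x) = 0
  D_shape (j k : ℕ) (hjk : j + 1 ≠ k) (z : T j) : D j k z = 0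
  D_D (i j k : ℕ) (z : T i) : D j k (D i j z) = 0
  π_D_succ_succ (p q j k : ℕ) (hj : p + (q + 1) = j) (hj' : p + 1 + q = j)
    (hk : p + 1 + (q + 1) = k) (z : T j) : π (p + 1) (q + 1) k hk (D j k z) =
      h p (q + 1) (π p (q + 1) j hj z) + v (p + 1) q (π (p + 1) q j hj' z)
  π_D_succ_zero (p j k : ℕ) (hj : p + 0 = j) (hk : p + 1 + 0 = k) (z : T j) :
    π (p + 1) 0 k hk (D j k z) = h p 0 (π p 0 j hj z)
  π_D_zero_succ (q j k : ℕ) (hj : 0 + q = j) (hk : 0 + (q + 1) = k) (z : T j) :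
    π 0 (q + 1) k hk (D j k z) = v 0 q (π 0 q j hj z)

namespace TotalData

variable {K : ℕ → ℕ → Type u} [∀ p q, AddCommGroup (K p q)]
  {T : ℕ → Type u} [∀ k, AddCommGroup (T k)] (S : TotalData K T)

/-- Interchange of the two directions. -/
def swap : TotalData (fun p q => K q p) T where
  h p q := S.v q p
  v p q := S.h q p
  D := S.D
  π p q k hk := S.π q p k (by omega)
  ι p q k hk := S.ι q p k (by omega)
  ext k z hz := S.ext k z fun p q hk => hz q p (by omega)
  π_ι_self p q k hk x := S.π_ι_self _ _ _ _ x
  π_ι_of_ne p q p' q' k hk hk' hp x := S.π_ι_of_ne _ _ _ _ _ _ _ (by omega) x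
  D_shape := S.D_shape
  D_D := S.D_D
  -- The signs are contained in `v`, so the two contributions simply change places.
  π_D_succ_succ p q j k hj hj' hk z :=
    (S.π_D_succ_succ q p j k (by omega) (by omega) (by omega) z).trans (add_comm _ _)
  π_D_succ_zero p j k hj hk z := S.π_D_zero_succ p j k (by omega) (by omega) z
  π_D_zero_succ q j k hj hk z := S.π_D_succ_zero q j k (by omega) (by omega) z

/-- The component of `D z` at `(p + 1, q)` is the sum of `h` of the component of `z` at `(p, q)` and
`v` of that at `(p + 1, q - 1)`. The latter vanishes when `z` has nothing beyond column `p`. -/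
theorem h_π_eq_zero {j k p q : ℕ} (hj : p + q = j) (hk : p + 1 + q = k) (z : T j)
    (hz : ∀ p' q' hj, p < p' → S.π p' q' j hj z = 0)
    (hD : S.π (p + 1) q k hk (S.D j k z) = 0) : S.h p q (S.π p q j hj z) = 0 := by
  cases q with
  | zero => rw [← hD, S.π_D_succ_zero p j k hj hk]
  | succ q =>
    rw [S.π_D_succ_succ p q j k hj (by omega) hk, hz (p + 1) q (by omega) (by omega), map_zero,
      add_zero] at hD
    exact hD

/-- If the lines in the first direction are exact in positive degrees, a cochain whose coboundary
lies on the axis `p = 0` is, up to a coboundary, on the axis `p = 0`. -/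
theorem exists_sub_D_concentrated
    (hex : ∀ p q (x : K (p + 1) q), S.h (p + 1) q x = 0 → ∃ w, S.h p q w = x) (k m : ℕ) :
    ∀ z : T k, (∀ p q hk, m < p → S.π p q k hk z = 0) →
      (∀ p q hk, 0 < p → S.π p q (k + 1) hk (S.D k (k + 1) z) = 0) →
      ∃ (j : ℕ) (w : T j), ∀ p q hk, 0 < p → S.π p q k hk (z - S.D j k w) = 0 := by
  induction m with
  | zero =>
    intro z hz _
    refine ⟨k, 0, fun p q hk hp => ?_⟩
    rw [map_zero, sub_zero]
    exact hz p q hk hp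
  | succ m ih =>
    intro z hz hD
    by_cases hmk : m + 1 ≤ k
    -- The outermost component sits at `(m + 1, q)` with `q = k - m - 1`. It is `h`-closed, so it
    -- equals `h x`.
    · obtain ⟨q, hq⟩ := Nat.exists_eq_add_of_le hmk
      obtain ⟨x, hx⟩ := hex m q (S.π (m + 1) q k hq.symm z)
        (S.h_π_eq_zero hq.symm (k := k + 1) (by omega) z hz (hD _ _ _ (by omega)))
      -- The coboundary of `x`, placed at `(m, q)` in total degree `k - 1`, has components only in
      -- columns `m` and `m + 1`, and the one in column `m + 1` is `h x`.
      set y := S.ι m q (m + q) rfl x with hy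
      have hmain : ∀ p q' hk, m < p →
          S.π p q' k hk (z - S.D (m + q) k y) = 0 := by
        intro p q' hk hp
        obtain ⟨p, rfl⟩ : ∃ p', p = p' + 1 := ⟨p - 1, by omega⟩
        have hDy : S.π (p + 1) q' k hk (S.D (m + q) k y) =
            S.h p q' (S.π p q' (m + q) (by omega) y) := by
          cases q' with
          | zero => rw [S.π_D_succ_zero p (m + q) k (by omega)]
          | succ q' =>
            rw [S.π_D_succ_succ p q' (m + q) k (by omega) (by omega),
              S.π_ι_of_ne m q (p + 1) q' _ _ _ (by omega), map_zero, add_zero]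
        rw [map_sub, hDy]
        by_cases hpm : p = m
        · subst hpm
          obtain rfl : q' = q := by omega
          rw [hy, S.π_ι_self, hx, sub_self]
        · rw [hy, S.π_ι_of_ne m q p q' _ _ _ (by omega), map_zero, sub_zero]
          exact hz _ _ _ (by omega)
      obtain ⟨j, w, hw⟩ := ih (z - S.D (m + q) k y) hmain fun p q' hk hp => by
        rw [map_sub, S.D_D, sub_zero]
        exact hD p q' hk hp
      -- The inductive correction `w` comes in an unspecified degree. If that is not `k - 1`, its
      -- coboundary in degree `k` is zero and `w` can be dropped.
      by_cases hj : j = m + q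
      · subst hj
        refine ⟨m + q, y + w, fun p q' hk hp => ?_⟩
        rw [map_add, ← sub_sub]
        exact hw p q' hk hp
      · refine ⟨m + q, y, fun p q' hk hp => ?_⟩
        have := hw p q' hk hp
        rwa [S.D_shape j k (by omega), sub_zero] at this
    · exact ih z (fun p q hk hp => by omega) hD

theorem exists_sub_D_concentrated'
    (hex : ∀ p q (x : K (p + 1) q), S.h (p + 1) q x = 0 → ∃ w, S.h p q w = x) (k : ℕ) (z : T k)
    (hD : ∀ p q hk, 0 < p → S.π p q (k + 1) hk (S.D k (k + 1) z) = 0) :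
    ∃ (j : ℕ) (w : T j), ∀ p q hk, 0 < p → S.π p q k hk (z - S.D j k w) = 0 :=
  -- In total degree `k` every column index is at most `k`, so the descent may start from `m = k`.
  S.exists_sub_D_concentrated hex k k z (fun p q hk hp => by omega) hD

/-! ### Comparison of the total complex with an augmentation along `p = 0`. -/

section Edge

variable {A : ℕ → Type u} [∀ k, AddCommGroup (A k)] (d : ∀ k, A k →+ A (k + 1))
  (ε : ∀ k, A k →+ K 0 k)

/-- Cocycles of the total complex are cohomologous to cocycles of the augmentation. -/
theorem exists_edge_eq
    (hex : ∀ p q (x : K (p + 1) q), S.h (p + 1) q x = 0 → ∃ w, S.h p q w = x)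
    (hε : ∀ k, Function.Injective (ε k)) (hεex : ∀ k x, S.h 0 k x = 0 → ∃ a, ε k a = x)
    (hv : ∀ k a, S.v 0 k (ε k a) = ε (k + 1) (d k a))
    (k : ℕ) (z : T k) (hz : S.D k (k + 1) z = 0) :
    ∃ a : A k, d k a = 0 ∧ ∃ (j : ℕ) (w : T j), z - S.ι 0 k k (zero_add k) (ε k a) = S.D j k w := by
  obtain ⟨j, w, hw⟩ := S.exists_sub_D_concentrated' hex k z fun p q hk hp => by rw [hz, map_zero]
  have hD : S.D k (k + 1) (z - S.D j k w) = 0 := by rw [map_sub, hz, S.D_D, sub_zero]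
  -- The corrected cocycle has only its component at `(0, k)`. Its coboundary has no component at
  -- `(1, k)`, so `h` kills it and it lies in the image of `ε`.
  obtain ⟨a, ha⟩ := hεex k _ (S.h_π_eq_zero (zero_add k) (k := k + 1) (by omega) _ hw
    (by rw [hD, map_zero]))
  refine ⟨a, ?_, j, w, ?_⟩
  · refine hε _ ?_
    rw [← hv, ha, ← S.π_D_zero_succ k k (k + 1) (by omega) (by omega), hD, map_zero, map_zero]
  · rw [sub_eq_iff_eq_add, ← sub_eq_iff_eq_add', ← sub_eq_zero]
    refine S.ext k _ fun p q hk => ?_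
    rw [map_sub]
    by_cases hp : p = 0
    · subst hp
      obtain rfl : q = k := by omega
      rw [S.π_ι_self, ha, sub_self]
    · rw [hw p q hk (by omega), S.π_ι_of_ne _ _ _ _ _ _ _ (by omega), sub_zero]

/-- A cocycle of the augmentation is a coboundary if its image in the total complex is one. -/
theorem exists_of_edge_eq_D
    (hex : ∀ p q (x : K (p + 1) q), S.h (p + 1) q x = 0 → ∃ w, S.h p q w = x)
    (hε : ∀ k, Function.Injective (ε k)) (hεex : ∀ k x, S.h 0 k x = 0 → ∃ a, ε k a = x)
    (hv : ∀ k a, S.v 0 k (ε k a) = ε (k + 1) (d k a))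
    (k : ℕ) (a : A k) (j : ℕ) (w : T j) (hw : S.ι 0 k k (zero_add k) (ε k a) = S.D j k w) :
    a = 0 ∨ ∃ (i : ℕ) (hi : i + 1 = k) (b : A i), a = hi ▸ d i b := by
  by_cases hj : j + 1 = k
  · subst hj
    -- The coboundary of `w` lies on `p = 0`, so `w` can be moved onto `p = 0` by a coboundary,
    -- which does not change `D w`.
    obtain ⟨i, y, hy⟩ := S.exists_sub_D_concentrated' hex j w fun p q hk hp => by
      rw [← hw, S.π_ι_of_ne _ _ _ _ _ _ _ (by omega)]
    have hD : S.D j (j + 1) (w - S.D i j y) = S.ι 0 (j + 1) (j + 1) (zero_add _) (ε _ a) := by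
      rw [map_sub, S.D_D, sub_zero, hw]
    obtain ⟨b, hb⟩ := hεex j _ (S.h_π_eq_zero (zero_add j) (k := j + 1) (by omega) _ hy
      (by rw [hD, S.π_ι_of_ne _ _ _ _ _ _ _ (by omega)]))
    refine Or.inr ⟨j, rfl, b, hε _ ?_⟩
    change ε (j + 1) a = ε (j + 1) (d j b)
    rw [← hv, hb, ← S.π_D_zero_succ j j (j + 1) (by omega) (by omega), hD, S.π_ι_self]
  -- Here the coboundary is zero by degree, as always when `k = 0`, and injectivity of `ε` gives `a
  -- = 0`.
  · rw [S.D_shape j k hj] at hw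
    refine Or.inl (hε k ?_)
    rw [map_zero, ← S.π_ι_self 0 k k (zero_add k) (ε k a), hw, map_zero]

end Edge

end TotalData

/-! ### The total complex of a double complex of modules -/

section Total

variable {R : Type} [Ring R]
  (K : HomologicalComplex₂ (ModuleCat.{u} R) (ComplexShape.up ℕ) (ComplexShape.up ℕ))

/-- The projection of the total complex of a double complex to a summand. -/
def totalπ (p q k : ℕ) (hk : p + q = k) : (K.total (ComplexShape.up ℕ)).X k ⟶ (K.X p).X q :=
  K.totalDesc fun p' q' hk' =>
    if hp : p' = p then (K.XXIsoOfEq (ModuleCat.{u} R) (ComplexShape.up ℕ) (ComplexShape.up ℕ) hp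
      (show q' = q by change p' + q' = k at hk'; omega)).hom else 0

theorem ιTotal_totalπ_self (p q k : ℕ) (hk : p + q = k) :
    K.ιTotal (ComplexShape.up ℕ) p q k hk ≫ totalπ K p q k hk = 𝟙 _ := by
  rw [totalπ, HomologicalComplex₂.ι_totalDesc, dif_pos rfl]
  rfl

theorem ιTotal_totalπ_of_ne (p q p' q' k : ℕ) (hk : p + q = k) (hk' : p' + q' = k) (hp : p ≠ p') :
    K.ιTotal (ComplexShape.up ℕ) p q k hk ≫ totalπ K p' q' k hk' = 0 := by
  rw [totalπ, HomologicalComplex₂.ι_totalDesc, dif_neg hp]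

theorem ιTotal_totalπ_self_assoc (p q k : ℕ) (hk : p + q = k) {Z : ModuleCat.{u} R}
    (f : (K.X p).X q ⟶ Z) :
    K.ιTotal (ComplexShape.up ℕ) p q k hk ≫ totalπ K p q k hk ≫ f = f := by
  rw [← Category.assoc, ιTotal_totalπ_self, Category.id_comp]

theorem ιTotal_totalπ_of_ne_assoc (p q p' q' k : ℕ) (hk : p + q = k) (hk' : p' + q' = k)
    (hp : p ≠ p') {Z : ModuleCat.{u} R} (f : (K.X p').X q' ⟶ Z) :
    K.ιTotal (ComplexShape.up ℕ) p q k hk ≫ totalπ K p' q' k hk' ≫ f = 0 := by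
  rw [← Category.assoc, ιTotal_totalπ_of_ne (hp := hp), zero_comp]

/-- This is `D = δ + (-1)^p d` on one summand: the sign attached to the first direction is `1`, that
of the second is `(-1)^p`. -/
theorem ιTotal_d (p q j k : ℕ) (hj : p + q = j) (hk : j + 1 = k) :
    K.ιTotal (ComplexShape.up ℕ) p q j hj ≫ (K.total (ComplexShape.up ℕ)).d j k =
      (K.d p (p + 1)).f q ≫ K.ιTotal (ComplexShape.up ℕ) (p + 1) q k (by
        change p + 1 + q = k; omega) +
      ((-1 : ℤˣ) ^ p • (K.X p).d q (q + 1)) ≫ K.ιTotal (ComplexShape.up ℕ) p (q + 1) k (by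
        change p + (q + 1) = k; omega) := by
  rw [HomologicalComplex₂.total_d, Preadditive.comp_add, HomologicalComplex₂.ι_D₁,
    HomologicalComplex₂.ι_D₂, K.d₁_eq (ComplexShape.up ℕ) (i₁' := p + 1) rfl q k (by
        change p + 1 + q = k; omega),
    K.d₂_eq (ComplexShape.up ℕ) p (i₂' := q + 1) rfl k (by change p + (q + 1) = k; omega),
    Linear.units_smul_comp]
  congr 1
  exact one_smul _ _

/-- Only finitely many summands have total degree `k`, so the identity is the sum over the
antidiagonal of projection followed by inclusion. This is checked on each summand. -/
theorem total_ext (k : ℕ) (z : (K.total (ComplexShape.up ℕ)).X k)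
    (hz : ∀ p q hk, totalπ K p q k hk z = 0) : z = 0 := by
  have h : 𝟙 _ = ∑ x : Finset.HasAntidiagonal.antidiagonal k, totalπ K x.1.1 x.1.2 k
      (Finset.HasAntidiagonal.mem_antidiagonal.1 x.2) ≫ K.ιTotal (ComplexShape.up ℕ) x.1.1 x.1.2 k
      (Finset.HasAntidiagonal.mem_antidiagonal.1 x.2) := by
    refine HomologicalComplex₂.total.hom_ext (ComplexShape.up ℕ) fun p q hk => ?_
    change p + q = k at hk
    rw [Category.comp_id, Preadditive.comp_sum, Finset.sum_eq_single
      ⟨(p, q), Finset.HasAntidiagonal.mem_antidiagonal.2 hk⟩]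
    · rw [← Category.assoc, ιTotal_totalπ_self, Category.id_comp]
    · rintro ⟨⟨p', q'⟩, hk'⟩ _ hne
      rw [Finset.HasAntidiagonal.mem_antidiagonal] at hk'
      dsimp only at hk' 
      rw [← Category.assoc, ιTotal_totalπ_of_ne, zero_comp]
      rintro rfl
      apply hne
      obtain rfl : q' = q := by omega
      rfl
    · intro h
      exact absurd (Finset.mem_univ _) h
  have h' := congrArg (fun φ => φ.hom z) h
  simp only [ModuleCat.hom_sum, LinearMap.sum_apply] at h'
  refine Eq.trans h' (Finset.sum_eq_zero fun x _ => ?_)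
  change K.ιTotal _ _ _ _ _ (totalπ K _ _ k _ z) = 0
  rw [hz, map_zero]

/-- Tested on the summand `(a, b)`, both sides vanish unless `a = p` or `a = p + 1`, and each of
these two summands accounts for one term. -/
theorem totalπ_d_succ_succ (p q j k : ℕ) (hj : p + (q + 1) = j) (hj' : p + 1 + q = j)
    (hk : p + 1 + (q + 1) = k) :
    (K.total (ComplexShape.up ℕ)).d j k ≫ totalπ K (p + 1) (q + 1) k hk =
      totalπ K p (q + 1) j hj ≫ (K.d p (p + 1)).f (q + 1) +
      totalπ K (p + 1) q j hj' ≫ ((-1 : ℤˣ) ^ (p + 1) • (K.X (p + 1)).d q (q + 1)) := by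
  refine HomologicalComplex₂.total.hom_ext (ComplexShape.up ℕ) fun a b hab => ?_
  change a + b = j at hab
  rw [← Category.assoc, ιTotal_d K a b j k hab (by omega), Preadditive.add_comp,
    Preadditive.comp_add, Category.assoc, Category.assoc]
  by_cases h1 : a = p
  · subst h1
    obtain rfl : b = q + 1 := by omega
    rw [ιTotal_totalπ_self, ιTotal_totalπ_self_assoc, ιTotal_totalπ_of_ne (hp := by omega),
      ιTotal_totalπ_of_ne_assoc (hp := by omega)]
    simp
  · by_cases h2 : a = p + 1
    · subst h2
      obtain rfl : b = q := by omega
      rw [ιTotal_totalπ_self, ιTotal_totalπ_self_assoc, ιTotal_totalπ_of_ne (hp := by omega),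
        ιTotal_totalπ_of_ne_assoc (hp := by omega)]
      simp
    · rw [ιTotal_totalπ_of_ne (hp := by omega), ιTotal_totalπ_of_ne (hp := by omega),
        ιTotal_totalπ_of_ne_assoc (hp := by omega), ιTotal_totalπ_of_ne_assoc (hp := by omega)]
      simp

theorem totalπ_d_succ_zero (p j k : ℕ) (hj : p + 0 = j) (hk : p + 1 + 0 = k) :
    (K.total (ComplexShape.up ℕ)).d j k ≫ totalπ K (p + 1) 0 k hk =
      totalπ K p 0 j hj ≫ (K.d p (p + 1)).f 0 := by
  refine HomologicalComplex₂.total.hom_ext (ComplexShape.up ℕ) fun a b hab => ?_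
  change a + b = j at hab
  rw [← Category.assoc, ιTotal_d K a b j k hab (by omega), Preadditive.add_comp,
    Category.assoc, Category.assoc]
  by_cases h1 : a = p
  · subst h1
    obtain rfl : b = 0 := by omega
    rw [ιTotal_totalπ_self, ιTotal_totalπ_self_assoc, ιTotal_totalπ_of_ne (hp := by omega)]
    simp
  · rw [ιTotal_totalπ_of_ne (hp := by omega), ιTotal_totalπ_of_ne (hp := by omega),
      ιTotal_totalπ_of_ne_assoc (hp := by omega)]
    simp

theorem totalπ_d_zero_succ (q j k : ℕ) (hj : 0 + q = j) (hk : 0 + (q + 1) = k) :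
    (K.total (ComplexShape.up ℕ)).d j k ≫ totalπ K 0 (q + 1) k hk =
      totalπ K 0 q j hj ≫ ((-1 : ℤˣ) ^ 0 • (K.X 0).d q (q + 1)) := by
  refine HomologicalComplex₂.total.hom_ext (ComplexShape.up ℕ) fun a b hab => ?_
  change a + b = j at hab
  rw [← Category.assoc, ιTotal_d K a b j k hab (by omega), Preadditive.add_comp,
    Category.assoc, Category.assoc]
  by_cases h1 : a = 0
  · subst h1
    obtain rfl : b = q := by omega
    rw [ιTotal_totalπ_self, ιTotal_totalπ_self_assoc, ιTotal_totalπ_of_ne (hp := by omega)]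
    simp
  · rw [ιTotal_totalπ_of_ne (hp := by omega), ιTotal_totalπ_of_ne (hp := by omega),
      ιTotal_totalπ_of_ne_assoc (hp := by omega)]
    simp

/-- The total complex of a double complex of modules in terms of elements. -/
def totalData : TotalData (fun p q => ((K.X p).X q : Type u))
    (fun k => ((K.total (ComplexShape.up ℕ)).X k : Type u)) where
  h p q := ((K.d p (p + 1)).f q).hom.toAddMonoidHom
  v p q := ((-1 : ℤˣ) ^ p • (K.X p).d q (q + 1)).hom.toAddMonoidHom
  D j k := ((K.total (ComplexShape.up ℕ)).d j k).hom.toAddMonoidHom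
  π p q k hk := (totalπ K p q k hk).hom.toAddMonoidHom
  ι p q k hk := (K.ιTotal (ComplexShape.up ℕ) p q k hk).hom.toAddMonoidHom
  ext := total_ext K
  π_ι_self p q k hk x := congrArg (fun φ => φ.hom x) (ιTotal_totalπ_self K p q k hk)
  π_ι_of_ne p q p' q' k hk hk' hp x :=
    congrArg (fun φ => φ.hom x) (ιTotal_totalπ_of_ne K p q p' q' k hk hk' hp)
  D_shape j k hjk z :=
    congrArg (fun φ => φ.hom z) ((K.total (ComplexShape.up ℕ)).shape j k hjk)
  D_D i j k z := congrArg (fun φ => φ.hom z) ((K.total (ComplexShape.up ℕ)).d_comp_d i j k)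
  π_D_succ_succ p q j k hj hj' hk z :=
    congrArg (fun φ => φ.hom z) (totalπ_d_succ_succ K p q j k hj hj' hk)
  π_D_succ_zero p j k hj hk z := congrArg (fun φ => φ.hom z) (totalπ_d_succ_zero K p j k hj hk)
  π_D_zero_succ q j k hj hk z := congrArg (fun φ => φ.hom z) (totalπ_d_zero_succ K q j k hj hk)

variable (A : CochainComplex (ModuleCat.{u} R) ℕ)

/-- If the lines of a double complex in the direction `p` are exact and resolve the complex `A`,
then the edge map from `A` to the total complex is a quasi-isomorphism. -/
theorem isIso_homologyMap_columnToTotal (f : A ⟶ K.X 0) (hf : f ≫ K.d 0 1 = 0)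
    (hmono : ∀ q, Function.Injective (f.f q))
    (hzero : ∀ q (x : (K.X 0).X q), (K.d 0 1).f q x = 0 → ∃ a, f.f q a = x)
    (hex : ∀ p q (x : (K.X (p + 1)).X q), (K.d (p + 1) (p + 2)).f q x = 0 →
      ∃ w, (K.d p (p + 1)).f q w = x) (k : ℕ) :
    IsIso (HomologicalComplex.homologyMap (columnToTotal K A f hf) k) := by
  have hv : ∀ q (a : A.X q), (totalData K).v 0 q (f.f q a) = f.f (q + 1) (A.d q (q + 1) a) :=
    fun q a => by
      have h := congrArg (fun φ => φ.hom a) (f.comm q (q + 1))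
      refine Eq.trans ?_ h
      change ((-1 : ℤˣ) ^ 0 • (K.X 0).d q (q + 1)) _ = _
      rw [pow_zero, one_smul]
      rfl
  refine isIso_homologyMap_of_elements _ k
    (fun z hz => (totalData K).exists_edge_eq (fun q => (A.d q (q + 1)).hom.toAddMonoidHom)
      (fun q => (f.f q).hom.toAddMonoidHom) hex hmono hzero hv k z hz)
    (fun a _ ⟨j, w, hw⟩ => ?_)
  rcases (totalData K).exists_of_edge_eq_D (fun q => (A.d q (q + 1)).hom.toAddMonoidHom)
    (fun q => (f.f q).hom.toAddMonoidHom) hex hmono hzero hv k a j w hw with rfl | ⟨i, rfl, b, hb⟩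
  · exact ⟨k, 0, (map_zero _).symm⟩
  · exact ⟨i, b, hb⟩

/-- If the lines of a double complex in the direction `q` are exact and resolve the complex `A`,
then the edge map from `A` to the total complex is a quasi-isomorphism. -/
theorem isIso_homologyMap_rowToTotal (f : ∀ p, A.X p ⟶ (K.X p).X 0)
    (hf : ∀ p, f p ≫ (K.d p (p + 1)).f 0 = A.d p (p + 1) ≫ f (p + 1))
    (hf' : ∀ p, f p ≫ (K.X p).d 0 1 = 0)
    (hmono : ∀ p, Function.Injective (f p))
    (hzero : ∀ p (x : (K.X p).X 0), (K.X p).d 0 1 x = 0 → ∃ a, f p a = x)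
    (hex : ∀ p q (x : (K.X p).X (q + 1)), (K.X p).d (q + 1) (q + 2) x = 0 →
      ∃ w, (K.X p).d q (q + 1) w = x) (k : ℕ) :
    IsIso (HomologicalComplex.homologyMap (rowToTotal K A f hf hf') k) := by
  -- The vertical map is `d` up to sign, so it has the same kernel and image as `d`; preimages are
  -- corrected by the inverse sign.
  have hsign : ∀ p q (x : (K.X p).X q), (totalData K).v p q x =
      (-1 : ℤˣ) ^ p • (K.X p).d q (q + 1) x := fun p q x => by
    rcases neg_one_pow_eq_or ℤˣ p with h | h
    · change ((-1 : ℤˣ) ^ p • (K.X p).d q (q + 1)) x = _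
      rw [h, one_smul, one_smul]
    · change ((-1 : ℤˣ) ^ p • (K.X p).d q (q + 1)) x = _
      rw [h, Units.neg_smul, one_smul, Units.neg_smul, one_smul]
      rfl
  have hv : ∀ p (a : A.X p), (totalData K).swap.v 0 p (f p a) = f (p + 1) (A.d p (p + 1) a) :=
    fun p a => congrArg (fun φ => φ.hom a) (hf p)
  have hzero' : ∀ p (x : (K.X p).X 0), (totalData K).swap.h 0 p x = 0 → ∃ a, f p a = x :=
    fun p x hx => hzero p x (by
      change (totalData K).v p 0 x = 0 at hx
      rwa [hsign, smul_eq_zero_iff_eq] at hx)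
  have hex' : ∀ q p (x : (K.X p).X (q + 1)), (totalData K).swap.h (q + 1) p x = 0 →
      ∃ w, (totalData K).swap.h q p w = x := fun q p x hx => by
    change (totalData K).v p (q + 1) x = 0 at hx
    rw [hsign, smul_eq_zero_iff_eq] at hx
    obtain ⟨w, hw⟩ := hex p q x hx
    refine ⟨((-1 : ℤˣ) ^ p)⁻¹ • w, ?_⟩
    change (totalData K).v p q _ = x
    rw [hsign, ← hw]
    rcases neg_one_pow_eq_or ℤˣ p with h | h
    · rw [h, inv_one, one_smul, one_smul]
    · rw [h, inv_neg, inv_one, Units.neg_smul, one_smul, Units.neg_smul, one_smul, map_neg, neg_neg]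
  refine isIso_homologyMap_of_elements _ k
    (fun z hz => (totalData K).swap.exists_edge_eq (fun p => (A.d p (p + 1)).hom.toAddMonoidHom)
      (fun p => (f p).hom.toAddMonoidHom) hex' hmono hzero' hv k z hz)
    (fun a _ ⟨j, w, hw⟩ => ?_)
  rcases (totalData K).swap.exists_of_edge_eq_D (fun p => (A.d p (p + 1)).hom.toAddMonoidHom)
    (fun p => (f p).hom.toAddMonoidHom) hex' hmono hzero' hv k a j w hw with rfl | ⟨i, rfl, b, hb⟩
  · exact ⟨k, 0, (map_zero _).symm⟩
  · exact ⟨i, b, hb⟩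

end Total

/-! ### Exactness of the Godement functors -/

section GodementExact

variable {R : Type} [Ring R] {X : TopCat.{u}}

/-- The map induced on stalks by a morphism of sheaves. -/
abbrev stalkMap {F G : TopCat.Sheaf (ModuleCat.{u} R) X} (φ : F ⟶ G) (x : X) :
    F.presheaf.stalk x ⟶ G.presheaf.stalk x :=
  (TopCat.Presheaf.stalkFunctor (ModuleCat.{u} R) x).map φ.hom

theorem stalkMap_comp {F G H : TopCat.Sheaf (ModuleCat.{u} R) X} (φ : F ⟶ G) (ψ : G ⟶ H) (x : X) :
    stalkMap (φ ≫ ψ) x = stalkMap φ x ≫ stalkMap ψ x :=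
  (TopCat.Presheaf.stalkFunctor (ModuleCat.{u} R) x).map_comp φ.hom ψ.hom

theorem stalkMap_comp_apply {F G H : TopCat.Sheaf (ModuleCat.{u} R) X} (φ : F ⟶ G) (ψ : G ⟶ H)
    (x : X) (t : F.presheaf.stalk x) : stalkMap (φ ≫ ψ) x t = stalkMap ψ x (stalkMap φ x t) := by
  rw [stalkMap_comp]
  rfl

theorem stalkMap_germ {F G : TopCat.Sheaf (ModuleCat.{u} R) X} (φ : F ⟶ G) (U : Opens X) (x : X)
    (hx : x ∈ U) (s : F.presheaf.obj (op U)) :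
    stalkMap φ x (F.presheaf.germ U x hx s) = G.presheaf.germ U x hx (φ.hom.app (op U) s) :=
  TopCat.Presheaf.stalkFunctor_map_germ_apply U x hx φ.hom s

theorem stalkMap_zero_apply {F G : TopCat.Sheaf (ModuleCat.{u} R) X} (x : X)
    (t : F.presheaf.stalk x) : stalkMap (0 : F ⟶ G) x t = 0 := by
  obtain ⟨U, hx, s, rfl⟩ := F.presheaf.exists_germ_eq t
  rw [stalkMap_germ]
  exact map_zero _

/-- Exactness of a sequence of sheaves of modules in terms of the elements of the stalks. -/
theorem sheaf_exact_iff (S : ShortComplex (TopCat.Sheaf (ModuleCat.{u} R) X)) :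
    S.Exact ↔ ∀ (x : X) (t : S.X₂.presheaf.stalk x), stalkMap S.g x t = 0 →
      ∃ s, stalkMap S.f x s = t := by
  rw [TopCat.Sheaf.exact_iff_stalkFunctor_map_exact]
  refine forall_congr' fun x => ?_
  rw [ShortComplex.moduleCat_exact_iff]
  rfl

/-- A morphism is mono exactly when it is exact after a zero map; taking that zero map from `F`
itself reduces the claim to exactness on stalks. -/
theorem sheaf_mono_iff {F G : TopCat.Sheaf (ModuleCat.{u} R) X} (φ : F ⟶ G) :
    Mono φ ↔ ∀ x, Function.Injective (stalkMap φ x) := by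
  constructor
  · intro hφ x
    rw [injective_iff_map_eq_zero]
    intro t ht
    obtain ⟨s, hs⟩ := (sheaf_exact_iff _).1 ((ShortComplex.exact_iff_mono
      (ShortComplex.mk (0 : F ⟶ F) φ zero_comp) rfl).2 hφ) x t ht
    exact hs.symm.trans (stalkMap_zero_apply x s)
  · intro h
    refine (ShortComplex.exact_iff_mono (ShortComplex.mk (0 : F ⟶ F) φ zero_comp) rfl).1 ?_
    rw [sheaf_exact_iff]
    intro x t ht
    exact ⟨0, by rw [map_zero]; exact (h x (ht.trans (map_zero _).symm)).symm⟩

theorem sheaf_epi_iff {F G : TopCat.Sheaf (ModuleCat.{u} R) X} (φ : F ⟶ G) :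
    Epi φ ↔ ∀ x, Function.Surjective (stalkMap φ x) := by
  constructor
  · intro hφ x t
    exact (sheaf_exact_iff _).1 ((ShortComplex.exact_iff_epi
      (ShortComplex.mk φ (0 : G ⟶ G) comp_zero) rfl).2 hφ) x t (stalkMap_zero_apply x t)
  · intro h
    refine (ShortComplex.exact_iff_epi (ShortComplex.mk φ (0 : G ⟶ G) comp_zero) rfl).1 ?_
    rw [sheaf_exact_iff]
    exact fun x t _ => h x t

theorem sheaf_shortExact (S : ShortComplex (TopCat.Sheaf (ModuleCat.{u} R) X)) (hS : S.Exact)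
    (hf : ∀ x, Function.Injective (stalkMap S.f x))
    (hg : ∀ x, Function.Surjective (stalkMap S.g x)) : S.ShortExact where
  exact := hS
  mono_f := (sheaf_mono_iff _).2 hf
  epi_g := (sheaf_epi_iff _).2 hg

theorem germ_eq_zero (F : TopCat.Sheaf (ModuleCat.{u} R) X) (U : Opens X) (x : X) (hx : x ∈ U)
    (s : F.presheaf.obj (op U)) (hs : F.presheaf.germ U x hx s = 0) :
    ∃ (V : Opens X) (h : V ≤ U), x ∈ V ∧ F.presheaf.map (homOfLE h).op s = 0 := by
  obtain ⟨W, hxW, i₁, i₂, h⟩ := F.presheaf.germ_eq x hx hx s 0 (hs.trans (map_zero _).symm)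
  exact ⟨W, i₁.le, hxW, h.trans (map_zero _)⟩

/-- A sequence of sheaves is exact if every section which is mapped to zero is locally in the
image. -/
theorem sheaf_exact_of_sections (S : ShortComplex (TopCat.Sheaf (ModuleCat.{u} R) X))
    (h : ∀ (U : Opens X) (x : X) (_ : x ∈ U) (s : S.X₂.presheaf.obj (op U)),
      S.g.hom.app (op U) s = 0 → ∃ (V : Opens X) (hV : V ≤ U) (_ : x ∈ V)
        (t : S.X₁.presheaf.obj (op V)),
        S.f.hom.app (op V) t = S.X₂.presheaf.map (homOfLE hV).op s) : S.Exact := by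
  rw [sheaf_exact_iff]
  intro x t ht
  obtain ⟨U, hx, s, rfl⟩ := S.X₂.presheaf.exists_germ_eq t
  rw [stalkMap_germ] at ht
  -- Only the germ of the image of `s` vanishes, so `s` is restricted to a neighbourhood on which
  -- its image is zero as a section.
  obtain ⟨W, hWU, hxW, hW⟩ := germ_eq_zero _ _ _ _ _ ht
  obtain ⟨V, hVW, hxV, t, ht⟩ := h W x hxW (S.X₂.presheaf.map (homOfLE hWU).op s) (by
    rw [← hW]
    exact congrArg (fun φ => φ.hom s) (S.g.hom.naturality (homOfLE hWU).op))
  refine ⟨S.X₁.presheaf.germ V x hxV t, ?_⟩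
  rw [stalkMap_germ, ht, TopCat.Presheaf.germ_res_apply, TopCat.Presheaf.germ_res_apply]

/-- The functor of sections of `C⁰F` over an open set is exact. -/
theorem godementZero_sections_exact (S : ShortComplex (TopCat.Sheaf (ModuleCat.{u} R) X))
    (hS : S.Exact) (U : Opens X) (s : ((godementZero R X).obj S.X₂).presheaf.obj (op U))
    (hs : ((godementZero R X).map S.g).hom.app (op U) s = 0) :
    ∃ t, ((godementZero R X).map S.f).hom.app (op U) t = s := by
  -- No compatibility between points is required in `C⁰`, so a preimage is chosen independently in
  -- each stalk.
  have h : ∀ x : U, ∃ t, stalkMap S.f x.1 t = s.1 x := fun x =>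
    (sheaf_exact_iff S).1 hS x.1 (s.1 x) (congrArg (fun f => f.1 x) hs)
  choose t ht using h
  exact ⟨⟨t, Submodule.mem_top⟩, Subtype.ext (funext ht)⟩

theorem godementZero_map_exact (S : ShortComplex (TopCat.Sheaf (ModuleCat.{u} R) X))
    (hS : S.Exact) : (S.map (godementZero R X)).Exact := by
  refine sheaf_exact_of_sections _ fun U x hx s hs => ?_
  obtain ⟨t, ht⟩ := godementZero_sections_exact S hS U s hs
  exact ⟨U, le_rfl, hx, t, ht.trans (by
    exact (congrArg (fun φ => φ.hom s)
      (((godementZero R X).obj S.X₂).presheaf.map_id (op U))).symm)⟩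

/-- A section of a sheaf is determined by its germs. -/
theorem toGodementZero_injective (F : TopCat.Sheaf (ModuleCat.{u} R) X) (U : Opens X) :
    Function.Injective ((toGodementZero F).hom.app (op U)) := by
  intro s t hst
  refine TopCat.Presheaf.section_ext F U s t fun x hx => ?_
  exact congrArg (fun f => f.1 ⟨x, hx⟩) hst

instance toGodementZero_mono (F : TopCat.Sheaf (ModuleCat.{u} R) X) : Mono (toGodementZero F) := by
  refine (ShortComplex.exact_iff_mono (ShortComplex.mk (0 : F ⟶ F) _ zero_comp) rfl).1 ?_
  refine sheaf_exact_of_sections _ fun U x hx s hs => ⟨U, le_rfl, hx, 0, ?_⟩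
  have : s = 0 := toGodementZero_injective F U (hs.trans (map_zero _).symm)
  rw [this, map_zero, map_zero]

/-- The short exact sequence `0 → F → C⁰F → Q¹ → 0`. -/
def godementSequence (F : TopCat.Sheaf (ModuleCat.{u} R) X) :
    ShortComplex (TopCat.Sheaf (ModuleCat.{u} R) X) :=
  ShortComplex.mk (toGodementZero F) (toGodementQuotient F)
    (toGodementZero_toGodementQuotient F)

theorem godementSequence_shortExact (F : TopCat.Sheaf (ModuleCat.{u} R) X) :
    (godementSequence F).ShortExact where
  exact := ShortComplex.exact_of_g_is_cokernel _ (cokernelIsCokernel (toGodementZero F))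
  mono_f := toGodementZero_mono F
  epi_g := toGodementQuotient_epi F

/-! ### The sequence `0 → F → C⁰F → Q¹ → 0` on elements of the stalks. -/

section Stalks

variable {F G : TopCat.Sheaf (ModuleCat.{u} R) X} (φ : F ⟶ G) (x : X)

theorem toGodementQuotient_stalk_surjective :
    Function.Surjective (stalkMap (toGodementQuotient F) x) :=
  (sheaf_epi_iff _).1 inferInstance x

theorem toGodementZero_stalk_injective : Function.Injective (stalkMap (toGodementZero F) x) :=
  (sheaf_mono_iff _).1 inferInstance x

theorem exists_toGodementZero_stalk (t : ((godementZero R X).obj F).presheaf.stalk x)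
    (ht : stalkMap (toGodementQuotient F) x t = 0) : ∃ s, stalkMap (toGodementZero F) x s = t :=
  (sheaf_exact_iff _).1 (godementSequence_shortExact F).exact x t ht

theorem stalk_toGodementZero_map (t : F.presheaf.stalk x) :
    stalkMap ((godementZero R X).map φ) x (stalkMap (toGodementZero F) x t) =
      stalkMap (toGodementZero G) x (stalkMap φ x t) := by
  rw [← stalkMap_comp_apply, ← stalkMap_comp_apply, toGodementZero_naturality]

theorem stalk_toGodementQuotient_map (t : ((godementZero R X).obj F).presheaf.stalk x) :
    stalkMap ((godementQuotient R X).map φ) x (stalkMap (toGodementQuotient F) x t) =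
      stalkMap (toGodementQuotient G) x (stalkMap ((godementZero R X).map φ) x t) := by
  rw [← stalkMap_comp_apply, ← stalkMap_comp_apply, toGodementQuotient_naturality]

theorem stalk_toGodementQuotient_toGodementZero (t : F.presheaf.stalk x) :
    stalkMap (toGodementQuotient F) x (stalkMap (toGodementZero F) x t) = 0 := by
  rw [← stalkMap_comp_apply, toGodementZero_toGodementQuotient,
    stalkMap_zero_apply]

end Stalks

/-- This is the 3×3 lemma on stalks, for the diagram with the sequences `0 → F → C⁰F → Q¹ → 0` of
the three terms: the line of the sheaves `F` and the line of the `C⁰F` are exact, so the line of the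
quotients is exact. -/
theorem godementQuotient_map_shortExact (S : ShortComplex (TopCat.Sheaf (ModuleCat.{u} R) X))
    (hS : S.ShortExact) : (S.map (godementQuotient R X)).ShortExact := by
  have hC' : ∀ S : ShortComplex (TopCat.Sheaf (ModuleCat.{u} R) X), S.ShortExact →
      (S.map (godementZero R X)).ShortExact :=
    ((godementZero R X).exact_tfae.out 1 0).1 godementZero_map_exact
  have hC := hC' S hS
  have := hS.mono_f
  have := hS.epi_g
  have hf := (sheaf_mono_iff S.f).1 inferInstance
  have hg := (sheaf_epi_iff S.g).1 inferInstance
  have hCf : ∀ x, Function.Injective (stalkMap ((godementZero R X).map S.f) x) :=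
    (sheaf_mono_iff _).1 hC.mono_f
  have hCg : ∀ x, Function.Surjective (stalkMap ((godementZero R X).map S.g) x) :=
    (sheaf_epi_iff _).1 hC.epi_g
  have hex := (sheaf_exact_iff _).1 hS.exact
  have hCex : ∀ (x : X) (t : ((godementZero R X).obj S.X₂).presheaf.stalk x),
      stalkMap ((godementZero R X).map S.g) x t = 0 →
        ∃ s, stalkMap ((godementZero R X).map S.f) x s = t := (sheaf_exact_iff _).1 hC.exact
  refine sheaf_shortExact _ ((sheaf_exact_iff _).2 fun x t ht => ?_) (fun x => ?_) fun x t => ?_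
  -- Exactness in the middle: a lift `c` of `t` maps in `C⁰S.X₃` to the image of some `f₃`.
  -- Subtracting from `c` the image of a lift `f₂` of `f₃` gives an element coming from `C⁰S.X₁`,
  -- without changing the class in the quotient.
  · obtain ⟨c, rfl⟩ := toGodementQuotient_stalk_surjective x t
    obtain ⟨f₃, hf₃⟩ := exists_toGodementZero_stalk x _
      ((stalk_toGodementQuotient_map S.g x c).symm.trans ht)
    obtain ⟨f₂, rfl⟩ := hg x f₃
    obtain ⟨c₁, hc₁⟩ := hCex x (c - stalkMap (toGodementZero S.X₂) x f₂) (by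
      rw [map_sub]
      refine sub_eq_zero.2 (hf₃.symm.trans ?_)
      exact (stalk_toGodementZero_map S.g x f₂).symm)
    refine ⟨stalkMap (toGodementQuotient S.X₁) x c₁, ?_⟩
    refine (stalk_toGodementQuotient_map S.f x c₁).trans ?_
    refine (congrArg (stalkMap (toGodementQuotient S.X₂) x) hc₁).trans ?_
    rw [map_sub, stalk_toGodementQuotient_toGodementZero, sub_zero]
  -- Injectivity on the left: the image of a lift `c` comes from `f₂`, which dies in `S.X₃` and so
  -- comes from some `f₁`. Then `c` is the image of `f₁` and its class is zero.
  · rw [injective_iff_map_eq_zero]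
    intro t ht
    obtain ⟨c, rfl⟩ := toGodementQuotient_stalk_surjective x t
    obtain ⟨f₂, hf₂⟩ := exists_toGodementZero_stalk x _
      ((stalk_toGodementQuotient_map S.f x c).symm.trans ht)
    obtain ⟨f₁, rfl⟩ := hex x f₂ (by
      refine toGodementZero_stalk_injective x ?_
      rw [← stalk_toGodementZero_map, hf₂, map_zero, ← stalkMap_comp_apply, ← Functor.map_comp,
        S.zero, Functor.map_zero, stalkMap_zero_apply])
    have : stalkMap (toGodementZero S.X₁) x f₁ = c := hCf x (by
      rw [← hf₂]
      exact stalk_toGodementZero_map S.f x f₁)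
    exact (congrArg (stalkMap (toGodementQuotient S.X₁) x) this.symm).trans
      (stalk_toGodementQuotient_toGodementZero x f₁)
  · obtain ⟨c, rfl⟩ := toGodementQuotient_stalk_surjective x t
    obtain ⟨c₂, rfl⟩ := hCg x c
    exact ⟨stalkMap (toGodementQuotient S.X₂) x c₂, stalk_toGodementQuotient_map S.g x c₂⟩

instance godementQuotient_preservesHomology : (godementQuotient R X).PreservesHomology :=
  ((godementQuotient R X).exact_tfae.out 0 2).1 godementQuotient_map_shortExact

theorem godementQ_map_exact (p : ℕ) (S : ShortComplex (TopCat.Sheaf (ModuleCat.{u} R) X))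
    (hS : S.Exact) : (S.map (godementQ R X p)).Exact := by
  induction p with
  | zero => exact hS
  | succ p ih => exact ih.map (godementQuotient R X)

/-- The functors `Γ(X, Cᵖ -)` are exact. -/
theorem godementΓ_exact (p : ℕ) (S : ShortComplex (TopCat.Sheaf (ModuleCat.{u} R) X))
    (hS : S.Exact) (s : (godementΓ R X p).obj S.X₂) (hs : (godementΓ R X p).map S.g s = 0) :
    ∃ t, (godementΓ R X p).map S.f t = s :=
  godementZero_sections_exact _ (godementQ_map_exact p S hS) ⊤ s hs

theorem godementΓ_injective (p : ℕ) {F G : TopCat.Sheaf (ModuleCat.{u} R) X} (φ : F ⟶ G) [Mono φ] :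
    Function.Injective ((godementΓ R X p).map φ) := by
  rw [injective_iff_map_eq_zero]
  intro s hs
  obtain ⟨t, rfl⟩ := godementΓ_exact p (ShortComplex.mk (0 : F ⟶ F) φ zero_comp)
    ((ShortComplex.exact_iff_mono _ rfl).2 inferInstance) s hs
  rw [Functor.map_zero]
  rfl

end GodementExact

/-! ### Fine sheaves are acyclic -/

section Fine

variable {R : Type} [Ring R] {X : TopCat.{u}}

/-- The map on stalks at `x`, evaluated at `t`, is additive in the morphism of sheaves. -/
def stalkEval (F G : TopCat.Sheaf (ModuleCat.{u} R) X) (x : X) (t : F.presheaf.stalk x) :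
    (F ⟶ G) →+ G.presheaf.stalk x where
  toFun φ := stalkMap φ x t
  map_zero' := stalkMap_zero_apply x t
  map_add' φ ψ := by
    obtain ⟨U, hx, s, rfl⟩ := F.presheaf.exists_germ_eq t
    rw [stalkMap_germ, stalkMap_germ, stalkMap_germ, ← map_add]
    rfl

/-- A morphism of sheaves which is zero on an open set. -/
def VanishesOn {F G : TopCat.Sheaf (ModuleCat.{u} R) X} (φ : F ⟶ G) (V : Opens X) : Prop :=
  ∀ x ∈ V, ∀ t : F.presheaf.stalk x, stalkMap φ x t = 0

/-- `C⁰φ` acts on a family of germs pointwise, so it kills all sections over open subsets of `V`.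
Openness of `V` matters, because a stalk of `C⁰F` involves the stalks of `F` at neighbouring points.
-/
theorem VanishesOn.godementZero {F G : TopCat.Sheaf (ModuleCat.{u} R) X} {φ : F ⟶ G}
    {V : Opens X} (h : VanishesOn φ V) : VanishesOn ((godementZero R X).map φ) V := by
  intro x hx t
  obtain ⟨U, hUV, hxU, s, rfl⟩ :=
    ((DeRham.godementZero R X).obj F).presheaf.exists_le_germ_eq t hx
  rw [stalkMap_germ]
  have : ((DeRham.godementZero R X).map φ).hom.app (op U) s = 0 :=
    Subtype.ext (funext fun y => h y.1 (hUV y.2) (s.1 y))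
  rw [this, map_zero]

theorem VanishesOn.godementQuotient {F G : TopCat.Sheaf (ModuleCat.{u} R) X} {φ : F ⟶ G}
    {V : Opens X} (h : VanishesOn φ V) : VanishesOn ((godementQuotient R X).map φ) V := by
  intro x hx t
  obtain ⟨c, rfl⟩ := toGodementQuotient_stalk_surjective x t
  rw [stalk_toGodementQuotient_map, h.godementZero x hx, map_zero]

/-- A sheaf is fine if it has partitions of unity by endomorphisms, subordinate to any open
covering. -/
def IsFine (F : TopCat.Sheaf (ModuleCat.{u} R) X) : Prop :=
  ∀ U : X → Opens X, (∀ x, x ∈ U x) → ∃ ρ : X → (F ⟶ F),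
    (∀ i, ∀ x ∉ U i, ∃ V : Opens X, x ∈ V ∧ VanishesOn (ρ i) V) ∧
    ∀ x, ∃ V : Opens X, x ∈ V ∧ ∃ J : Finset X, (∀ i ∉ J, VanishesOn (ρ i) V) ∧
      VanishesOn (∑ i ∈ J, ρ i - 𝟙 F) V

/-- The functor `Q¹` is additive, so it carries the partition of unity to one, and it preserves
vanishing on open sets. -/
theorem IsFine.quotient {F : TopCat.Sheaf (ModuleCat.{u} R) X} (hF : IsFine F) :
    IsFine ((godementQuotient R X).obj F) := by
  intro U hU
  obtain ⟨ρ, h1, h2⟩ := hF U hU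
  refine ⟨fun i => (DeRham.godementQuotient R X).map (ρ i), fun i x hx => ?_, fun x => ?_⟩
  · obtain ⟨V, hxV, hV⟩ := h1 i x hx
    exact ⟨V, hxV, hV.godementQuotient⟩
  · obtain ⟨V, hxV, J, hJ, hV⟩ := h2 x
    refine ⟨V, hxV, J, fun i hi => (hJ i hi).godementQuotient, ?_⟩
    have := hV.godementQuotient
    rwa [Functor.map_sub, Functor.map_sum, CategoryTheory.Functor.map_id] at this

theorem IsFine.iteratedQuotient {F : TopCat.Sheaf (ModuleCat.{u} R) X} (hF : IsFine F) (p : ℕ) :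
    IsFine ((godementQ R X p).obj F) := by
  induction p with
  | zero => exact hF
  | succ p ih => exact ih.quotient

/-- A section of `Q¹` is, near a given point, the image of a global section of `C⁰F`. -/
theorem exists_local_lift (F : TopCat.Sheaf (ModuleCat.{u} R) X)
    (h : ((godementQuotient R X).obj F).presheaf.obj (op ⊤)) (x : X) :
    ∃ (U : Opens X) (_ : x ∈ U) (g : ((godementZero R X).obj F).presheaf.obj (op ⊤)), ∀ y ∈ U,
      stalkMap (toGodementQuotient F) y
          (((godementZero R X).obj F).presheaf.germ ⊤ y (Opens.mem_top y) g) =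
        ((godementQuotient R X).obj F).presheaf.germ ⊤ y (Opens.mem_top y) h := by
  obtain ⟨c, hc⟩ := toGodementQuotient_stalk_surjective x
    (((godementQuotient R X).obj F).presheaf.germ ⊤ x (Opens.mem_top x) h)
  obtain ⟨W, hxW, s, rfl⟩ := ((godementZero R X).obj F).presheaf.exists_germ_eq c
  rw [stalkMap_germ] at hc
  obtain ⟨U, hxU, i₁, i₂, hU⟩ := TopCat.Presheaf.germ_eq _ x hxW
    (show x ∈ (⊤ : Opens X) from trivial) _ _ hc
  classical
  -- Sections of `C⁰F` may be discontinuous, so a local lift over `W` extends by zero to all of `X`.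
  let g : ((godementZero R X).obj F).presheaf.obj (op ⊤) :=
    ⟨fun y => if hy : y.1 ∈ W then s.1 ⟨y.1, hy⟩ else 0, Submodule.mem_top⟩
  have hg : ((godementZero R X).obj F).presheaf.map (homOfLE le_top : W ⟶ ⊤).op g = s :=
    Subtype.ext (funext fun y => dif_pos y.2)
  refine ⟨U, hxU, g, fun y hy => ?_⟩
  rw [← TopCat.Presheaf.germ_res_apply ((godementZero R X).obj F).presheaf
    (homOfLE le_top : W ⟶ ⊤) y (i₁.le hy) g, hg, stalkMap_germ,
    ← TopCat.Presheaf.germ_res_apply _ i₁ y hy, hU, TopCat.Presheaf.germ_res_apply]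

/-- For a fine sheaf `F`, the map `Γ(X, C⁰F) → Γ(X, Q¹)` is surjective. -/
theorem IsFine.toGodementQuotient_surjective {F : TopCat.Sheaf (ModuleCat.{u} R) X}
    (hF : IsFine F) :
    Function.Surjective ((globalSections R X).map (toGodementQuotient F)) := by
  intro h
  choose U hxU g hg using exists_local_lift F h
  obtain ⟨ρ, hρ, hρ'⟩ := hF U hxU
  choose V hxV J hJ hV using hρ'
  -- The glued lift is `∑ ρ i (g i)`, formed in each stalk. The sum is finite at every point, and
  -- over `V x` it is the sum over the fixed finite set `J x`.
  let γ : ((godementZero R X).obj F).presheaf.obj (op ⊤) :=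
    ⟨fun y => ∑ᶠ i, stalkMap (ρ i) y.1 ((g i).1 y), Submodule.mem_top⟩
  refine ⟨γ, ?_⟩
  refine TopCat.Presheaf.section_ext ((godementQuotient R X).obj F) ⊤ _ _ fun x hx => ?_
  have hγ : ((godementZero R X).obj F).presheaf.map (homOfLE le_top : V x ⟶ ⊤).op γ =
      ((godementZero R X).obj F).presheaf.map (homOfLE le_top : V x ⟶ ⊤).op
        (∑ i ∈ J x, ((godementZero R X).map (ρ i)).hom.app (op ⊤) (g i)) := by
    refine Subtype.ext (funext fun y => ?_)
    have h1 : (∑ᶠ i, stalkMap (ρ i) y.1 ((g i).1 ⟨y.1, Opens.mem_top y.1⟩)) =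
        ∑ i ∈ J x, stalkMap (ρ i) y.1 ((g i).1 ⟨y.1, Opens.mem_top y.1⟩) := by
      refine finsum_eq_sum_of_support_subset _ fun i hi => ?_
      by_contra hiJ
      exact hi (hJ x i hiJ y.1 y.2 _)
    refine Eq.trans h1 ?_
    let ev : ((godementZero R X).obj F).presheaf.obj (op ⊤) →+ F.presheaf.stalk y.1 :=
      { toFun := fun f => f.1 ⟨y.1, Opens.mem_top y.1⟩
        map_zero' := rfl
        map_add' := fun _ _ => rfl }
    exact (map_sum ev (fun i => ((godementZero R X).map (ρ i)).hom.app (op ⊤) (g i)) (J x)).symm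
  have hgerm : ((godementZero R X).obj F).presheaf.germ ⊤ x (Opens.mem_top x) γ =
      ∑ i ∈ J x, stalkMap ((godementZero R X).map (ρ i)) x
        (((godementZero R X).obj F).presheaf.germ ⊤ x (Opens.mem_top x) (g i)) := by
    rw [← TopCat.Presheaf.germ_res_apply _ (homOfLE le_top : V x ⟶ ⊤) x (hxV x), hγ,
      TopCat.Presheaf.germ_res_apply, map_sum]
    exact Finset.sum_congr rfl fun i _ => (stalkMap_germ _ _ _ _ _).symm
  have hone : ∑ i ∈ J x, stalkMap ((godementQuotient R X).map (ρ i)) x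
      (((godementQuotient R X).obj F).presheaf.germ ⊤ x (Opens.mem_top x) h) =
        ((godementQuotient R X).obj F).presheaf.germ ⊤ x (Opens.mem_top x) h := by
    have h1 := (hV x).godementQuotient x (hxV x)
      (((godementQuotient R X).obj F).presheaf.germ ⊤ x (Opens.mem_top x) h)
    rw [Functor.map_sub, Functor.map_sum, CategoryTheory.Functor.map_id] at h1
    change stalkEval _ _ x _ _ = 0 at h1
    rw [map_sub, map_sum, sub_eq_zero] at h1
    refine Eq.trans h1 ?_
    change stalkMap (𝟙 _) x _ = _
    exact stalkMap_germ (𝟙 _) ⊤ x (Opens.mem_top x) h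
  change ((godementQuotient R X).obj F).presheaf.germ ⊤ x (Opens.mem_top x)
    ((toGodementQuotient F).hom.app (op ⊤) γ) = _
  rw [← stalkMap_germ, hgerm, map_sum, ← hone]
  refine Finset.sum_congr rfl fun i _ => ?_
  rw [← stalk_toGodementQuotient_map]
  -- At points of `U i` the section `g i` lifts `h`; elsewhere it need not, but there `ρ i` vanishes
  -- near `x` and both terms are zero.
  by_cases hi : x ∈ U i
  · rw [hg i x hi]
  · obtain ⟨W, hxW, hW⟩ := hρ i x hi
    rw [hW.godementQuotient x hxW, hW.godementQuotient x hxW]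

/-- A global section of `C⁰F` with zero image in `Q¹` comes from a section of `F`. -/
theorem exists_section_of_toGodementQuotient_eq_zero (F : TopCat.Sheaf (ModuleCat.{u} R) X)
    (s : (globalSections R X).obj ((godementZero R X).obj F))
    (hs : (globalSections R X).map (toGodementQuotient F) s = 0) :
    ∃ a, (globalSections R X).map (toGodementZero F) a = s := by
  have : HasLimits (ModuleCat.{u} R) := ModuleCat.hasLimits
  -- Global sections are left exact: the inclusion into presheaves and evaluation at an open set
  -- both preserve finite limits.
  have hlim : PreservesFiniteLimits (globalSections R X) := by
    have : PreservesFiniteLimits (TopCat.Sheaf.forget (ModuleCat.{u} R) X) :=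
      inferInstanceAs (PreservesFiniteLimits
        (sheafToPresheaf (Opens.grothendieckTopology X) (ModuleCat.{u} R)))
    have : PreservesFiniteLimits
        ((evaluation (Opens X)ᵒᵖ (ModuleCat.{u} R)).obj (op (⊤ : Opens X))) :=
      ⟨fun _ _ _ => inferInstance⟩
    exact comp_preservesFiniteLimits _ _
  have h : ∀ S : ShortComplex (TopCat.Sheaf (ModuleCat.{u} R) X), S.ShortExact →
      (S.map (globalSections R X)).Exact ∧ Mono ((globalSections R X).map S.f) :=
    ((globalSections R X).preservesFiniteLimits_tfae.out 3 0).1 hlim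
  exact (ShortComplex.moduleCat_exact_iff _).1 (h _ (godementSequence_shortExact F)).1 s hs

/-- `δ` factors as `C⁰F → Q¹ → C⁰Q¹`, and the second map is injective on sections, so the kernel of
`δ` is that of the projection to `Q¹`. -/
theorem exists_section_of_godementδZero_eq_zero (F : TopCat.Sheaf (ModuleCat.{u} R) X)
    (s : (globalSections R X).obj ((godementZero R X).obj F))
    (hs : (globalSections R X).map (godementδZero F) s = 0) :
    ∃ a, (globalSections R X).map (toGodementZero F) a = s := by
  refine exists_section_of_toGodementQuotient_eq_zero F s ?_
  refine toGodementZero_injective ((godementQuotient R X).obj F) ⊤ ?_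
  refine Eq.trans ?_ (map_zero _).symm
  rw [godementδZero, Functor.map_comp] at hs
  exact hs

/-- Fine sheaves are acyclic. -/
theorem IsFine.godementΓδ_exact {F : TopCat.Sheaf (ModuleCat.{u} R) X} (hF : IsFine F) (p : ℕ)
    (s : (godementΓ R X (p + 1)).obj F) (hs : (godementΓδ R X (p + 1)).app F s = 0) :
    ∃ t, (godementΓδ R X p).app F t = s := by
  -- A cocycle in `C⁰Q^{p+1}` comes from a global section of `Q^{p+1}`, which lifts to `C⁰Q^p`
  -- because `Q^p` is fine.
  obtain ⟨a, ha⟩ := exists_section_of_godementδZero_eq_zero ((DeRham.godementQ R X (p + 1)).obj F)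
    s hs
  obtain ⟨t, ht⟩ := (hF.iteratedQuotient p).toGodementQuotient_surjective a
  refine ⟨t, ?_⟩
  change (globalSections R X).map (godementδZero ((DeRham.godementQ R X p).obj F)) t = s
  rw [godementδZero, Functor.map_comp, ← ha, ← ht]
  rfl

end Fine

/-! ### Hypercohomology of complexes of fine sheaves and of resolutions -/

section Hyper

variable {R : Type} [Ring R] {X : TopCat.{u}}
  (L : CochainComplex (TopCat.Sheaf (ModuleCat.{u} R) X) ℕ)

/-- The hypercohomology of a complex of fine sheaves is the cohomology of its complex of global
sections. -/
theorem isIso_homologyMap_sectionsToHyper (hL : ∀ q, IsFine (L.X q)) (k : ℕ) :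
    IsIso (HomologicalComplex.homologyMap (sectionsToHyper L) k) := by
  refine isIso_homologyMap_columnToTotal _ _ _ _
    (fun q => toGodementZero_injective (L.X q) ⊤) (fun q x hx => ?_) (fun p q x hx => ?_) k
  · rw [doubleComplex_d] at hx
    exact exists_section_of_godementδZero_eq_zero (L.X q) x hx
  · rw [doubleComplex_d] at hx
    obtain ⟨w, hw⟩ := (hL q).godementΓδ_exact p x hx
    refine ⟨w, ?_⟩
    rw [doubleComplex_d]
    exact hw

/-- The hypercohomology of a resolution `F → L⁰ → L¹ → ⋯` is the cohomology of `F`. -/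
theorem isIso_homologyMap_godementToHyper {F : TopCat.Sheaf (ModuleCat.{u} R) X} (i : F ⟶ L.X 0)
    (hi : i ≫ L.d 0 1 = 0) [Mono i] (hzero : (ShortComplex.mk i (L.d 0 1) hi).Exact)
    (hex : ∀ q, (ShortComplex.mk (L.d q (q + 1)) (L.d (q + 1) (q + 2))
      (L.d_comp_d _ _ _)).Exact) (k : ℕ) :
    IsIso (HomologicalComplex.homologyMap (godementToHyper L i hi) k) :=
  isIso_homologyMap_rowToTotal _ _ _ _ _ (fun p => godementΓ_injective p i)
    (fun p x hx => godementΓ_exact p _ hzero x hx)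
    (fun p q x hx => godementΓ_exact p _ (hex q) x hx) k

end Hyper

/-! ### Smooth dependence of integrals on parameters -/

section Parametric

open MeasureTheory Set Metric

/-- The derivative in `x` is again jointly smooth in `(x, t)`, which allows differentiation under
the integral to be repeated. -/
theorem continuous_uncurry_fderiv {E G : Type} [NormedAddCommGroup E] [NormedSpace ℝ E]
    [NormedAddCommGroup G] [NormedSpace ℝ G] {f : E → ℝ → G}
    (hf : ContDiff ℝ ∞ (Function.uncurry f)) :
    ContDiff ℝ ∞ (Function.uncurry fun x t => fderiv ℝ (fun y => f y t) x) := by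
  have h : ContDiff ℝ ∞ (Function.uncurry fun (z : E × ℝ) (y : E) => f y z.2) :=
    hf.comp (contDiff_snd.prodMk (contDiff_snd.comp contDiff_fst))
  exact ContDiff.fderiv (m := ∞) h contDiff_fst (by simp)

/-- Differentiation under the integral by dominated convergence. The bound is the supremum of the
norm of the derivative over the product of the closed unit ball and `[0, 1]`, compact since `E` is
finite dimensional. -/
theorem hasFDerivAt_intervalIntegral_of_contDiff {E G : Type} [NormedAddCommGroup E]
    [NormedSpace ℝ E] [FiniteDimensional ℝ E] [NormedAddCommGroup G] [NormedSpace ℝ G]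
    {f : E → ℝ → G} (hf : ContDiff ℝ ∞ (Function.uncurry f)) (x₀ : E) :
    HasFDerivAt (fun x => ∫ t in (0 : ℝ)..1, f x t)
      (∫ t in (0 : ℝ)..1, fderiv ℝ (fun y => f y t) x₀) x₀ := by
  have hproper : ProperSpace E := FiniteDimensional.proper ℝ E
  have hf' := (continuous_uncurry_fderiv hf).continuous
  have hc : ∀ x, Continuous (f x) := fun x =>
    hf.continuous.comp (continuous_const.prodMk continuous_id)
  have hc' : Continuous fun t => fderiv ℝ (fun y => f y t) x₀ :=
    hf'.comp (continuous_const.prodMk continuous_id)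
  obtain ⟨C, hC⟩ :=
    ((isCompact_closedBall x₀ 1).prod (isCompact_Icc (a := (0 : ℝ)) (b := 1))).bddAbove_image
    hf'.norm.continuousOn
  refine intervalIntegral.hasFDerivAt_integral_of_dominated_of_fderiv_le
    (F := f) (F' := fun x t => fderiv ℝ (fun y => f y t) x) (bound := fun _ => C)
    (closedBall_mem_nhds x₀ one_pos) (.of_forall fun x => (hc x).aestronglyMeasurable)
    ((hc x₀).intervalIntegrable 0 1) hc'.aestronglyMeasurable
    (.of_forall fun t ht x hx => ?_) intervalIntegrable_const
    (.of_forall fun t _ x _ => ?_)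
  · rw [uIoc_of_le zero_le_one] at ht
    exact hC ⟨(x, t), ⟨hx, Ioc_subset_Icc_self ht⟩, rfl⟩
  · have h : ContDiff ℝ ∞ fun y => f y t := hf.comp (contDiff_id.prodMk contDiff_const)
    exact (h.differentiable (by simp) x).hasFDerivAt

theorem clm_intervalIntegral_fderiv {E G H : Type} [NormedAddCommGroup E]
    [NormedSpace ℝ E] [FiniteDimensional ℝ E] [NormedAddCommGroup G] [NormedSpace ℝ G]
    [CompleteSpace G] [NormedAddCommGroup H] [NormedSpace ℝ H] [CompleteSpace H] {f : E → ℝ → G}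
    (hf : ContDiff ℝ ∞ (Function.uncurry f)) (x : E) (L : (E →L[ℝ] G) →L[ℝ] H) :
    L (∫ t in (0 : ℝ)..1, fderiv ℝ (fun y => f y t) x) =
      ∫ t in (0 : ℝ)..1, L (fderiv ℝ (fun y => f y t) x) :=
  (L.intervalIntegral_comp_comm (((continuous_uncurry_fderiv hf).continuous.comp
    (continuous_const.prodMk continuous_id)).intervalIntegrable 0 1)).symm

/-- Induction on `m` over all target spaces at once, since the derivative takes values in `E →L[ℝ]
G`. -/
theorem contDiff_intervalIntegral {E : Type} [NormedAddCommGroup E]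
    [NormedSpace ℝ E] [FiniteDimensional ℝ E] (m : ℕ) :
    ∀ {G : Type} [NormedAddCommGroup G] [NormedSpace ℝ G] {f : E → ℝ → G},
      ContDiff ℝ ∞ (Function.uncurry f) → ContDiff ℝ m fun x => ∫ t in (0 : ℝ)..1, f x t := by
  induction m with
  | zero =>
    intro G _ _ f hf
    have : Differentiable ℝ fun x => ∫ t in (0 : ℝ)..1, f x t := fun x =>
      (hasFDerivAt_intervalIntegral_of_contDiff hf x).differentiableAt
    exact contDiff_zero.2 this.continuous
  | succ m ih =>
    intro G _ _ f hf
    rw [Nat.cast_add, Nat.cast_one, contDiff_succ_iff_fderiv]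
    refine ⟨fun x => (hasFDerivAt_intervalIntegral_of_contDiff hf x).differentiableAt, by simp, ?_⟩
    have : (fderiv ℝ fun x => ∫ t in (0 : ℝ)..1, f x t) =
        fun x => ∫ t in (0 : ℝ)..1, fderiv ℝ (fun y => f y t) x :=
      funext fun x => (hasFDerivAt_intervalIntegral_of_contDiff hf x).fderiv
    rw [this]
    exact ih (continuous_uncurry_fderiv hf)

theorem contDiff_clm_comp {E G H : Type} [NormedAddCommGroup E] [NormedSpace ℝ E]
    [NormedAddCommGroup G] [NormedSpace ℝ G] [NormedAddCommGroup H] [NormedSpace ℝ H]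
    (L : G →L[ℝ] H) {f : E → G} (hf : ContDiff ℝ ∞ f) : ContDiff ℝ ∞ fun x => L (f x) :=
  L.contDiff.comp hf

theorem hasFDerivAt_clm_comp {E G H : Type} [NormedAddCommGroup E] [NormedSpace ℝ E]
    [NormedAddCommGroup G] [NormedSpace ℝ G] [NormedAddCommGroup H] [NormedSpace ℝ H]
    (L : G →L[ℝ] H) {f : E → G} {f' : E →L[ℝ] G} {x : E} (hf : HasFDerivAt f f' x) :
    HasFDerivAt (fun x => L (f x)) (L.comp f') x :=
  L.hasFDerivAt.comp x hf

end Parametric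

/-! ### The Poincaré lemma -/

section Poincare

open MeasureTheory Set Metric ContinuousAlternatingMap

variable {E : Type} [NormedAddCommGroup E] [NormedSpace ℝ E]

/-- If the alternatization of `A` is zero, then that of the contraction of `A` with `x` is `A x`. -/
theorem alternatizeUncurryFin_contract {k : ℕ} (A : E →L[ℝ] E [⋀^Fin (k + 1)]→L[ℝ] ℝ)
    (hA : alternatizeUncurryFin A = 0) (x : E) (L : E →L[ℝ] E [⋀^Fin k]→L[ℝ] ℝ)
    (hL : ∀ v, L v = (A v).curryLeft x) : alternatizeUncurryFin L = A x := by
  ext v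
  -- In the expansion of the alternatization on `(x, v)`, the term omitting `x` is `A x v`, and the
  -- other terms add up to minus the alternatization of the contraction.
  have h : alternatizeUncurryFin A (Matrix.vecCons x v) = 0 := by rw [hA]; rfl
  rw [alternatizeUncurryFin_apply, Fin.sum_univ_succ] at h
  rw [alternatizeUncurryFin_apply]
  have h0 : (0 : Fin (k + 2)).removeNth (Matrix.vecCons x v) = v := by
    funext j
    simp [Fin.removeNth]
  have hs : ∀ i : Fin (k + 1), i.succ.removeNth (Matrix.vecCons x v) =
      Matrix.vecCons x (i.removeNth v) := by
    intro i
    funext j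
    refine Fin.cases ?_ (fun j => ?_) j
    · simp [Fin.removeNth]
    · simp [Fin.removeNth]
  rw [h0] at h
  simp only [hs, Fin.val_zero, pow_zero, one_smul, Matrix.cons_val_zero, Matrix.cons_val_succ,
    Fin.val_succ, pow_succ, mul_neg, mul_one, neg_smul, Finset.sum_neg_distrib] at h
  rw [add_neg_eq_zero] at h
  rw [h]
  refine Finset.sum_congr rfl fun i _ => ?_
  rw [hL]
  rfl

/-- Currying of alternating forms in the first variable, as a continuous linear map. -/
def curryLeftCLM (E : Type) [NormedAddCommGroup E] [NormedSpace ℝ E] (k : ℕ) :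
    (E [⋀^Fin (k + 1)]→L[ℝ] ℝ) →L[ℝ] (E →L[ℝ] E [⋀^Fin k]→L[ℝ] ℝ) :=
  (curryLeftLI (𝕜 := ℝ) (E := E) (F := ℝ) (n := k)).toContinuousLinearMap

/-- The integrand of the homotopy operator of the Poincaré lemma, centered at `c`. -/
def homotopyIntegrand {k : ℕ} (c : E) (w : E → E [⋀^Fin (k + 1)]→L[ℝ] ℝ) (x : E) (t : ℝ) :
    E [⋀^Fin k]→L[ℝ] ℝ :=
  t ^ k • (w (c + t • (x - c))).curryLeft (x - c)

theorem contDiff_homotopyIntegrand {k : ℕ} (c : E) {w : E → E [⋀^Fin (k + 1)]→L[ℝ] ℝ}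
    (hw : ContDiff ℝ ∞ w) : ContDiff ℝ ∞ (Function.uncurry (homotopyIntegrand c w)) := by
  have h1 : ContDiff ℝ ∞ fun z : E × ℝ => c + z.2 • (z.1 - c) := by fun_prop
  have h2 : ContDiff ℝ ∞ fun z : E × ℝ => (w (c + z.2 • (z.1 - c))).curryLeft :=
    contDiff_clm_comp (G := E [⋀^Fin (k + 1)]→L[ℝ] ℝ) (H := E →L[ℝ] E [⋀^Fin k]→L[ℝ] ℝ)
      (curryLeftCLM E k) (hw.comp h1)
  have h3 : ContDiff ℝ ∞ fun z : E × ℝ => z.2 ^ k := by fun_prop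
  have h4 : ContDiff ℝ ∞ fun z : E × ℝ => z.1 - c := by fun_prop
  exact h3.smul (h2.clm_apply h4)

theorem hasFDerivAt_line (c x : E) (t : ℝ) :
    HasFDerivAt (fun y => c + t • (y - c)) (t • ContinuousLinearMap.id ℝ E) x :=
  (((hasFDerivAt_id x).sub_const c).const_smul t).const_add c

theorem fderiv_homotopyIntegrand_apply {k : ℕ} (c : E) {w : E → E [⋀^Fin (k + 1)]→L[ℝ] ℝ}
    (hw : ContDiff ℝ ∞ w) (x : E) (t : ℝ) (v : E) :
    fderiv ℝ (fun y => homotopyIntegrand c w y t) x v =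
      t ^ k • ((w (c + t • (x - c))).curryLeft v +
        t • (fderiv ℝ w (c + t • (x - c)) v).curryLeft (x - c)) := by
  have h1 : HasFDerivAt (fun y => w (c + t • (y - c)))
      ((fderiv ℝ w (c + t • (x - c))).comp (t • ContinuousLinearMap.id ℝ E)) x :=
    ((hw.differentiable (by simp) _).hasFDerivAt).comp x (hasFDerivAt_line c x t)
  have h2 := hasFDerivAt_clm_comp (G := E [⋀^Fin (k + 1)]→L[ℝ] ℝ)
    (H := E →L[ℝ] E [⋀^Fin k]→L[ℝ] ℝ) (curryLeftCLM E k) h1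
  have h3 := (h2.clm_apply ((hasFDerivAt_id x).sub_const c)).const_smul (t ^ k)
  have h4 : HasFDerivAt (fun y => homotopyIntegrand c w y t) _ x := h3
  rw [h4.fderiv]
  simp
  rfl

/-- Cartan's formula for the radial field: alternatizing `w.curryLeft` gives `(k + 1) w`, and since
`w` is closed at the point, alternatizing the contracted derivative gives the derivative in the
direction `x - c`. The result is the `t`-derivative computed in `hasDerivAt_pow_smul_line`. -/
theorem alternatizeUncurryFin_fderiv_homotopyIntegrand {k : ℕ} (c : E)
    {w : E → E [⋀^Fin (k + 1)]→L[ℝ] ℝ} (hw : ContDiff ℝ ∞ w) (x : E) (t : ℝ)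
    (hd : extDeriv w (c + t • (x - c)) = 0) :
    alternatizeUncurryFin (fderiv ℝ (fun y => homotopyIntegrand c w y t) x) =
      ((k + 1 : ℝ) * t ^ k) • w (c + t • (x - c)) +
        t ^ (k + 1) • fderiv ℝ w (c + t • (x - c)) (x - c) := by
  set y := c + t • (x - c) with hy
  let L : E →L[ℝ] E [⋀^Fin k]→L[ℝ] ℝ :=
    ((curryLeftCLM E k).comp
      (fderiv ℝ w y)).flip (x - c)
  have hL : ∀ v, L v = (fderiv ℝ w y v).curryLeft (x - c) := fun v => rfl
  have h : fderiv ℝ (fun y => homotopyIntegrand c w y t) x =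
      t ^ k • ((w y).curryLeft + t • L) := by
    ext1 v
    rw [fderiv_homotopyIntegrand_apply c hw]
    rfl
  rw [h, alternatizeUncurryFin_smul, alternatizeUncurryFin_add, alternatizeUncurryFin_smul,
    alternatizeUncurryFin_curryLeft, alternatizeUncurryFin_contract _ hd _ L hL, smul_add,
    smul_smul, ← pow_succ, ← Nat.cast_smul_eq_nsmul ℝ, smul_smul, mul_comm, Nat.cast_add,
    Nat.cast_one]

theorem hasDerivAt_pow_smul_line {k : ℕ} (c : E) {w : E → E [⋀^Fin (k + 1)]→L[ℝ] ℝ}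
    (hw : ContDiff ℝ ∞ w) (x : E) (t : ℝ) :
    HasDerivAt (fun t : ℝ => t ^ (k + 1) • w (c + t • (x - c)))
      (((k + 1 : ℝ) * t ^ k) • w (c + t • (x - c)) +
        t ^ (k + 1) • fderiv ℝ w (c + t • (x - c)) (x - c)) t := by
  have h1 : HasDerivAt (fun t : ℝ => c + t • (x - c)) (x - c) t := by
    have := ((hasDerivAt_id t).smul_const (x - c)).const_add c
    simpa using this
  have h2 := ((hw.differentiable (by simp) _).hasFDerivAt).comp_hasDerivAt t h1
  have h3 := (hasDerivAt_pow (k + 1) t).smul h2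
  have h4 : HasDerivAt (fun t : ℝ => t ^ (k + 1) • w (c + t • (x - c))) _ t := h3
  refine h4.congr_deriv ?_
  rw [add_comm (t ^ (k + 1) • _)]
  simp

variable [FiniteDimensional ℝ E]

/-- The Poincaré lemma for a globally defined form which is closed on a convex set. -/
theorem extDeriv_homotopy {k : ℕ} (c : E) {w : E → E [⋀^Fin (k + 1)]→L[ℝ] ℝ}
    (hw : ContDiff ℝ ∞ w) (x : E) (hd : ∀ t ∈ Icc (0 : ℝ) 1, extDeriv w (c + t • (x - c)) = 0) :
    extDeriv (fun x => ∫ t in (0 : ℝ)..1, homotopyIntegrand c w x t) x = w x := by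
  have hsm := contDiff_homotopyIntegrand c hw
  have h1 : extDeriv (fun x => ∫ t in (0 : ℝ)..1, homotopyIntegrand c w x t) x =
      ∫ t in (0 : ℝ)..1, (((k + 1 : ℝ) * t ^ k) • w (c + t • (x - c)) +
        t ^ (k + 1) • fderiv ℝ w (c + t • (x - c)) (x - c)) := by
    rw [extDeriv, (hasFDerivAt_intervalIntegral_of_contDiff hsm x).fderiv,
      ← alternatizeUncurryFinCLM_apply]
    refine (clm_intervalIntegral_fderiv (G := E [⋀^Fin k]→L[ℝ] ℝ) (H := E [⋀^Fin (k + 1)]→L[ℝ] ℝ)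
      hsm x (alternatizeUncurryFinCLM ℝ E ℝ)).trans ?_
    refine intervalIntegral.integral_congr fun t ht => ?_
    rw [uIcc_of_le zero_le_one] at ht
    exact alternatizeUncurryFin_fderiv_homotopyIntegrand c hw x t (hd t ht)
  have hcont : Continuous fun t : ℝ => ((k + 1 : ℝ) * t ^ k) • w (c + t • (x - c)) +
        t ^ (k + 1) • fderiv ℝ w (c + t • (x - c)) (x - c) := by
    have h1 : Continuous fun t : ℝ => c + t • (x - c) := by fun_prop
    have h2 := hw.continuous.comp h1
    have h3 := ((hw.continuous_fderiv (by simp)).comp h1).clm_apply (continuous_const (y := x - c))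
    exact ((continuous_const.mul (continuous_pow k)).smul h2).add ((continuous_pow (k + 1)).smul h3)
  -- By the fundamental theorem of calculus the integral is the change of `t^(k+1) w(c + t(x-c))`
  -- from `0` to `1`. The value at `0` vanishes because the exponent is positive.
  rw [h1, intervalIntegral.integral_eq_sub_of_hasDerivAt
    (fun t _ => hasDerivAt_pow_smul_line c hw x t) (hcont.intervalIntegrable 0 1)]
  simp

/-- The Poincaré lemma: a closed form is locally exact. -/
theorem exists_extDeriv_eq {k : ℕ} {w : E → E [⋀^Fin (k + 1)]→L[ℝ] ℝ} {Ω : Set E}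
    (hΩ : IsOpen Ω) (hw : ContDiffOn ℝ ∞ w Ω) (hd : ∀ y ∈ Ω, extDeriv w y = 0) {c : E}
    (hc : c ∈ Ω) : ∃ r > 0, ball c r ⊆ Ω ∧ ∃ η : E → E [⋀^Fin k]→L[ℝ] ℝ, ContDiff ℝ ∞ η ∧
      ∀ y ∈ ball c r, extDeriv η y = w y := by
  obtain ⟨R, hR, hRΩ⟩ := Metric.nhds_basis_closedBall.mem_iff.1 (hΩ.mem_nhds hc)
  -- The homotopy operator is applied to globally smooth forms, so `w` is cut off outside `Ω`. The
  -- product agrees with `w` on the ball of radius `R / 2`, whose convexity keeps the segments from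
  -- `c` where the product is closed.
  let χ : ContDiffBump c := ⟨R / 2, R, by positivity, by linarith⟩
  have hsm : ContDiff ℝ ∞ fun x => χ x • w x := by
    rw [contDiff_iff_contDiffAt]
    intro x
    by_cases hx : x ∈ Ω
    · exact χ.contDiff.contDiffAt.smul (hw.contDiffAt (hΩ.mem_nhds hx))
    · have hx' : x ∉ tsupport χ := fun h => hx (hRΩ (χ.tsupport_eq ▸ h))
      refine (contDiffAt_const (c := 0)).congr_of_eventuallyEq ?_
      filter_upwards [(notMem_tsupport_iff_eventuallyEq.1 hx')] with y hy
      rw [hy, Pi.zero_apply, zero_smul]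
  have heq : ∀ y ∈ ball c (R / 2), (fun x => χ x • w x) =ᶠ[𝓝 y] w := fun y hy => by
    filter_upwards [isOpen_ball.mem_nhds hy] with z hz
    rw [χ.one_of_mem_closedBall (ball_subset_closedBall hz), one_smul]
  have hsub : ball c (R / 2) ⊆ Ω := fun y hy =>
    hRΩ (ball_subset_closedBall (ball_subset_ball (by linarith) hy))
  refine ⟨R / 2, by positivity, hsub, fun x => ∫ t in (0 : ℝ)..1,
    homotopyIntegrand c (fun x => χ x • w x) x t, contDiff_infty.2 fun m =>
      contDiff_intervalIntegral m (contDiff_homotopyIntegrand c hsm), fun y hy => ?_⟩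
  rw [extDeriv_homotopy c hsm y fun t ht => ?_, (heq y hy).eq_of_nhds]
  have hmem : c + t • (y - c) ∈ ball c (R / 2) :=
    (convex_ball c (R / 2)).add_smul_sub_mem (mem_ball_self (by positivity)) hy ht
  rw [(heq _ hmem).extDeriv_eq, hd _ (hsub hmem)]

end Poincare

/-! ### Smoothness of families of alternating maps -/

section Alternating

variable {E F : Type} [NormedAddCommGroup E] [NormedSpace ℝ E] [NormedAddCommGroup F]
  [NormedSpace ℝ F] {k : ℕ}

/-- Evaluation `(A, v) ↦ A v` is jointly analytic, since `A` is multilinear in `v` and the value is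
linear in `A`. -/
theorem contDiffAt_alternating_apply {f : F → E [⋀^Fin k]→L[ℝ] ℝ} {v : F → Fin k → E} {x : F}
    (hf : ContDiffAt ℝ ∞ f x) (hv : ContDiffAt ℝ ∞ v x) :
    ContDiffAt ℝ ∞ (fun y => f y (v y)) x := by
  have h := (ContinuousLinearMap.analyticAt_uncurry_of_multilinear
    (ContinuousAlternatingMap.toContinuousMultilinearMapCLM (𝕜 := ℝ) (E := E) (F := ℝ)
      (ι := Fin k) ℝ) (x := (f x, v x))).contDiffAt (n := ∞)
  exact h.comp x (hf.prodMk hv)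

/-- A family of alternating maps is smooth if its values are. -/
theorem contDiffAt_alternating [FiniteDimensional ℝ E] {f : F → E [⋀^Fin k]→L[ℝ] ℝ} {x : F}
    (h : ∀ v, ContDiffAt ℝ ∞ (fun y => f y v) x) : ContDiffAt ℝ ∞ f x := by
  -- The values on tuples of basis vectors embed the alternating maps linearly in a
  -- finite-dimensional space; a linear left inverse is continuous there and recovers `f` smoothly
  -- from these values.
  let b := Module.finBasis ℝ E
  let Φ : (E [⋀^Fin k]→L[ℝ] ℝ) →ₗ[ℝ] ((Fin k → Fin (Module.finrank ℝ E)) → ℝ) :=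
    { toFun := fun A s => A (b ∘ s)
      map_add' := fun _ _ => rfl
      map_smul' := fun _ _ => rfl }
  have hΦ : LinearMap.ker Φ = ⊥ := by
    refine LinearMap.ker_eq_bot'.2 fun A hA => ?_
    apply ContinuousAlternatingMap.toAlternatingMap_injective
    exact Module.Basis.ext_alternating b fun s _ => congrFun hA s
  obtain ⟨g, hg⟩ := Φ.exists_leftInverse_of_injective hΦ
  have h1 : ContDiffAt ℝ ∞ (fun y => Φ (f y)) x := contDiffAt_pi.2 fun s => h _
  have h2 := (LinearMap.toContinuousLinearMap g).contDiff.contDiffAt.comp x h1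
  refine h2.congr_of_eventuallyEq (.of_forall fun y => ?_)
  exact (LinearMap.congr_fun hg (f y)).symm

theorem contDiffAt_alternating_comp [FiniteDimensional ℝ E] {f : F → E [⋀^Fin k]→L[ℝ] ℝ}
    {g : F → E →L[ℝ] E} {x : F} (hf : ContDiffAt ℝ ∞ f x) (hg : ContDiffAt ℝ ∞ g x) :
    ContDiffAt ℝ ∞ (fun y => (f y).compContinuousLinearMap (g y)) x :=
  contDiffAt_alternating fun v => contDiffAt_alternating_apply (v := fun y i => g y (v i)) hf
    (contDiffAt_pi.2 fun _ => hg.clm_apply contDiffAt_const)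

end Alternating

/-! ### Local exactness of the de Rham complex -/

section Manifold

variable {n : ℕ} {M : Type u} [TopologicalSpace M] [ChartedSpace (EuclideanSpace ℝ (Fin n)) M]

local notation "𝔼" => EuclideanSpace ℝ (Fin n)

theorem chartForm_zero {k : ℕ} (e : OpenPartialHomeomorph M 𝔼) (U : Opens M) :
    chartForm e (0 : ∀ x : U, AltForm n M k x) = 0 := by
  simpa using chartForm_smul (n := n) (M := M) (U := U) (k := k) e 0 0

/-- The pullback of a form on Euclidean space along a chart. -/
def pullForm {k : ℕ} (e : OpenPartialHomeomorph M 𝔼) (η : 𝔼 → 𝔼 [⋀^Fin k]→L[ℝ] ℝ) (V : Opens M)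
    (x : V) : AltForm n M k x :=
  ContinuousAlternatingMap.compContinuousLinearMap (M := 𝔼) (M' := 𝔼) (η (e x))
    (mfderiv (𝓡 n) (𝓡 n) e x.1)

variable [IsManifold (𝓡 n) ∞ M]

theorem chartForm_pullForm {k : ℕ} {e : OpenPartialHomeomorph M 𝔼} (he : e ∈ atlas 𝔼 M)
    (η : 𝔼 → 𝔼 [⋀^Fin k]→L[ℝ] ℝ) {V : Opens M} {y : 𝔼} (hy : y ∈ chartDomain e V) :
    chartForm e (pullForm e η V) y = η y := by
  rw [chartForm_eq e _ hy.2 rfl]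
  have key := (mdifferentiable_of_mem_atlas (I := 𝓡 n) he).comp_symm_deriv hy.1
  have hv : ∀ w : 𝔼, (mfderiv (𝓡 n) (𝓡 n) e (e.symm y) : 𝔼 →L[ℝ] 𝔼)
      ((mfderiv (𝓡 n) (𝓡 n) e.symm y : 𝔼 →L[ℝ] 𝔼) w) = w :=
    fun w => congrArg (fun L : 𝔼 →L[ℝ] 𝔼 => L w) key
  ext v
  have h : η (e (e.symm y)) v = η y v := by rw [e.right_inv hy.1]
  refine Eq.trans ?_ h
  exact congrArg (fun w : Fin k → 𝔼 => η (e (e.symm y)) w) (funext fun i => hv (v i))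

/-- The differentials of `e` and `e.symm` are mutually inverse, so the chart expression determines
the form at the point; equalities of forms can thus be checked in one chart. -/
theorem apply_eq_chartForm {k : ℕ} {e : OpenPartialHomeomorph M 𝔼} (he : e ∈ atlas 𝔼 M)
    {V : Opens M} (α : ∀ x : V, AltForm n M k x) (x : V) (hx : x.1 ∈ e.source)
    (v : Fin k → TangentSpace (𝓡 n) x.1) :
    α x v = chartForm e α (e x) fun i =>
      (mfderiv (𝓡 n) (𝓡 n) e x.1 : 𝔼 →L[ℝ] 𝔼) (v i) := by
  rw [chartForm_eq e α x.2 (e.left_inv hx)]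
  have key := mfderiv_chart_symm_comp he hx
  have hv : ∀ w : 𝔼, (mfderiv (𝓡 n) (𝓡 n) e.symm (e x.1) : 𝔼 →L[ℝ] 𝔼)
      ((mfderiv (𝓡 n) (𝓡 n) e x.1 : 𝔼 →L[ℝ] 𝔼) w) = w :=
    fun w => congrArg (fun L : 𝔼 →L[ℝ] 𝔼 => L w) key
  exact congrArg (fun w : Fin k → 𝔼 => (α x : 𝔼 [⋀^Fin k]→L[ℝ] ℝ) w)
    (funext fun i => (hv (v i)).symm)

theorem eq_of_chartForm_eq {k : ℕ} {e : OpenPartialHomeomorph M 𝔼} (he : e ∈ atlas 𝔼 M)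
    {V : Opens M} {α β : ∀ x : V, AltForm n M k x} (x : V) (hx : x.1 ∈ e.source)
    (h : chartForm e α (e x) = chartForm e β (e x)) : α x = β x := by
  ext v
  rw [apply_eq_chartForm he α x hx, apply_eq_chartForm he β x hx, h]

/-- A form on an open subset of the domain of a chart is smooth if its expression in this chart
is. -/
theorem isSmoothForm_of_chart {k : ℕ} {e : OpenPartialHomeomorph M 𝔼} (he : e ∈ atlas 𝔼 M)
    {V : Opens M} (hV : ∀ x ∈ V, x ∈ e.source) {α : ∀ x : V, AltForm n M k x}
    (h : ContDiffOn ℝ ∞ (chartForm e α) (chartDomain e V)) : IsSmoothForm α := by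
  intro e' he' y hy
  have hys := hV _ hy.2
  have hz : (e ∘ e'.symm) y ∈ chartDomain e V :=
    ⟨e.map_source hys, by
      change e.symm (e (e'.symm y)) ∈ V
      rw [e.left_inv hys]
      exact hy.2⟩
  have h1 := contDiffAt_transition he' he hy.1 hys
  have h2 := (h.contDiffAt ((isOpen_chartDomain e V).mem_nhds hz)).comp y h1
  have h3 := contDiffAt_alternating_comp h2 (h1.fderiv_right (m := ∞) (by simp))
  refine (h3.congr_of_eventuallyEq ?_).contDiffWithinAt
  filter_upwards [(isOpen_chartDomain e' V).mem_nhds hy] with z hz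
  exact chartForm_transition α he' he hz (hV _ hz.2)

theorem extDeriv_chartForm_eq_zero {k : ℕ} {U : Opens M} {α : ∀ x : U, AltForm n M k x}
    (hα : IsSmoothForm α) (hd : dForm α = 0) {e : OpenPartialHomeomorph M 𝔼} (he : e ∈ atlas 𝔼 M)
    {y : 𝔼} (hy : y ∈ chartDomain e U) : extDeriv (chartForm e α) y = 0 := by
  rw [← chartForm_dForm hα he hy, hd, chartForm_zero]
  rfl

/-- The part of the domain of a chart which is mapped to an open set. -/
def chartPreimage (e : OpenPartialHomeomorph M 𝔼) {s : Set 𝔼} (hs : IsOpen s) : Opens M :=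
  ⟨e.source ∩ e ⁻¹' s, e.isOpen_inter_preimage hs⟩

/-- A closed form of positive degree is locally exact. -/
theorem exists_dForm_eq {k : ℕ} {U : Opens M} {α : ∀ x : U, AltForm n M (k + 1) x}
    (hα : IsSmoothForm α) (hd : dForm α = 0) {x : M} (hx : x ∈ U) :
    ∃ (V : Opens M) (hV : V ≤ U), x ∈ V ∧ ∃ β : ∀ x : V, AltForm n M k x, IsSmoothForm β ∧
      dForm β = fun y : V => α ⟨y, hV y.2⟩ := by
  have he := chart_mem_atlas 𝔼 x
  have hxs := mem_chart_source 𝔼 x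
  have hxd := mem_chartDomain_chartAt (n := n) (⟨x, hx⟩ : U)
  set e := chartAt 𝔼 x
  -- The Euclidean Poincaré lemma gives a primitive on a ball around `e x`; its pullback to the
  -- preimage of the ball is the required form.
  obtain ⟨r, hr, hrU, η, hη, hηα⟩ := exists_extDeriv_eq (isOpen_chartDomain e U) (hα e he)
    (fun y hy => extDeriv_chartForm_eq_zero hα hd he hy) hxd
  let V : Opens M := chartPreimage e (Metric.isOpen_ball (x := e x) (ε := r))
  have hVU : V ≤ U := fun y hy => Set.mem_of_eq_of_mem (e.left_inv hy.1).symm (hrU hy.2).2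
  have hβ : IsSmoothForm (pullForm e η V) := isSmoothForm_of_chart he
    (fun y (hy : y ∈ V) => hy.1)
    (hη.contDiffOn.congr fun y hy => chartForm_pullForm he η hy)
  refine ⟨V, hVU, ⟨hxs, Metric.mem_ball_self hr⟩, pullForm e η V, hβ, funext fun y => ?_⟩
  have hy : e y.1 ∈ chartDomain e V := ⟨e.map_source y.2.1, by
    rw [Set.mem_preimage, e.left_inv y.2.1]
    exact y.2⟩
  refine eq_of_chartForm_eq he (β := fun y : V => α ⟨y, hVU y.2⟩) y y.2.1 ?_
  have hev : chartForm e (pullForm e η V) =ᶠ[𝓝 (e y.1)] η := by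
    filter_upwards [(isOpen_chartDomain e V).mem_nhds hy] with z hz
    exact chartForm_pullForm he η hz
  rw [chartForm_dForm hβ he hy, hev.extDeriv_eq, hηα _ y.2.2]
  exact (chartForm_restrict e hVU α hy.2).symm

/-- A closed form of degree zero is locally constant. -/
theorem exists_zeroForm_eq {U : Opens M} {α : ∀ x : U, AltForm n M 0 x}
    (hα : IsSmoothForm α) (hd : dForm α = 0) {x : M} (hx : x ∈ U) :
    ∃ (V : Opens M) (hV : V ≤ U), x ∈ V ∧ ∃ c : ℝ,
      zeroForm (fun _ : V => c) = fun y : V => α ⟨y, hV y.2⟩ := by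
  have he := chart_mem_atlas 𝔼 x
  have hxs := mem_chart_source 𝔼 x
  have hxd := mem_chartDomain_chartAt (n := n) (⟨x, hx⟩ : U)
  set e := chartAt 𝔼 x
  obtain ⟨r, hr, hrU⟩ := Metric.isOpen_iff.1 (isOpen_chartDomain e U) _ hxd
  let V : Opens M := chartPreimage e (Metric.isOpen_ball (x := e x) (ε := r))
  have hVU : V ≤ U := fun y hy => Set.mem_of_eq_of_mem (e.left_inv hy.1).symm (hrU hy.2).2
  -- The constant is the value of the chart expression at `e x` on the empty tuple, here written
  -- `0`.
  refine ⟨V, hVU, ⟨hxs, Metric.mem_ball_self hr⟩, chartForm e α (e x) 0, funext fun y => ?_⟩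
  -- In degree zero the alternatization has a single term, so `extDeriv` is the ordinary derivative.
  -- It vanishes on the ball, which is connected.
  have hfd : Set.EqOn (fderiv ℝ (chartForm e α)) 0 (Metric.ball (e x) r) := fun z hz => by
    have h := extDeriv_chartForm_eq_zero hα hd he (hrU hz)
    ext v w
    have h' : extDeriv (chartForm e α) z (fun _ => v) = 0 := by rw [h]; rfl
    rw [extDeriv, ContinuousAlternatingMap.alternatizeUncurryFin_apply, Fin.sum_univ_one] at h'
    simp only [Fin.val_zero, pow_zero, one_smul] at h'
    rw [Subsingleton.elim w ((0 : Fin 1).removeNth fun _ => v)]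
    exact h'
  have hconst := Metric.isOpen_ball.is_const_of_fderiv_eq_zero
    (convex_ball (e x) r).isPreconnected
    (((hα e he).mono hrU).differentiableOn (by simp)) hfd y.2.2 (Metric.mem_ball_self hr)
  ext v
  refine Eq.trans ?_ (apply_eq_chartForm he α ⟨y, hVU y.2⟩ y.2.1 v).symm
  change chartForm e α (e x) 0 = chartForm e α (e y) _
  rw [hconst]
  exact congrArg (chartForm e α (e x)) (Subsingleton.elim _ _)

variable (n M) in
theorem deRhamComplex_d (k : ℕ) : (deRhamComplex n M).d k (k + 1) = formSheafD n M k :=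
  CochainComplex.of_d (formSheaf n M) (formSheafD n M) k

variable (n M) in
/-- The Poincaré lemma: the de Rham complex of sheaves is exact in positive degrees. -/
theorem deRhamComplex_exact (k : ℕ) :
    (ShortComplex.mk ((deRhamComplex n M).d k (k + 1)) ((deRhamComplex n M).d (k + 1) (k + 2))
      ((deRhamComplex n M).d_comp_d _ _ _)).Exact := by
  refine sheaf_exact_of_sections _ fun U x hx α hα => ?_
  have hα' : (formSheafD n M (k + 1)).hom.app (op U) α = 0 := by
    rw [← deRhamComplex_d]
    exact hα
  obtain ⟨V, hV, hxV, β, hβ, hd⟩ := exists_dForm_eq (n := n) (M := M) (U := U) (α := α.1) α.2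
    (congrArg Subtype.val hα') hx
  refine ⟨V, hV, hxV, (⟨β, hβ⟩ : (smoothForms n M k).carrier V), ?_⟩
  refine Eq.trans (b := (formSheafD n M k).hom.app (op V)
    (⟨β, hβ⟩ : (smoothForms n M k).carrier V)) ?_ (Subtype.ext hd)
  exact congrArg (fun φ : formSheaf n M k ⟶ formSheaf n M (k + 1) => φ.hom.app (op V)
    (⟨β, hβ⟩ : (smoothForms n M k).carrier V)) (deRhamComplex_d n M k)

variable (n M) in
/-- The kernel of `d : 𝒜⁰ → 𝒜¹` is the sheaf of locally constant functions. -/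
theorem realToForm_exact :
    (ShortComplex.mk (realToForm n M) ((deRhamComplex n M).d 0 1) (realToForm_d n M)).Exact := by
  refine sheaf_exact_of_sections _ fun U x hx α hα => ?_
  have hα' : (formSheafD n M 0).hom.app (op U) α = 0 := by
    rw [← deRhamComplex_d]
    exact hα
  obtain ⟨V, hV, hxV, c, hc⟩ := exists_zeroForm_eq (n := n) (M := M) (U := U) (α := α.1) α.2
    (congrArg Subtype.val hα') hx
  exact ⟨V, hV, hxV, (⟨fun _ => c, IsLocallyConstant.const c⟩ :
    (locallyConstantFunctions (TopCat.of M)).carrier V), Subtype.ext hc⟩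

instance realToForm_mono : Mono (realToForm n M) := by
  refine (ShortComplex.exact_iff_mono (ShortComplex.mk
    (0 : realSheaf (TopCat.of M) ⟶ realSheaf (TopCat.of M)) _ zero_comp) rfl).1 ?_
  refine sheaf_exact_of_sections _ fun U x hx f hf => ⟨U, le_rfl, hx, 0, ?_⟩
  have : f = 0 := by
    refine Subtype.ext (funext fun y => ?_)
    -- Evaluating a form of degree zero on the empty tuple recovers the function.
    have h := congrArg (fun α : (smoothForms n M 0).carrier U => α.1 y 0) hf
    exact h
  rw [this, map_zero, map_zero]

end Manifold

/-! ### The sheaves of differential forms are fine -/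

section FormsFine

theorem vanishesOn_of_sections {R : Type} [Ring R] {X : TopCat.{u}}
    {F G : TopCat.Sheaf (ModuleCat.{u} R) X} {φ : F ⟶ G} {V : Opens X}
    (h : ∀ (W : Opens X) (_ : W ≤ V) (s : F.presheaf.obj (op W)), φ.hom.app (op W) s = 0) :
    VanishesOn φ V := by
  intro x hx t
  obtain ⟨U, hUV, hxU, s, rfl⟩ := F.presheaf.exists_le_germ_eq t hx
  rw [stalkMap_germ, h U hUV, map_zero]

variable {n : ℕ} {M : Type u} [TopologicalSpace M] [ChartedSpace (EuclideanSpace ℝ (Fin n)) M]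

local notation "𝔼" => EuclideanSpace ℝ (Fin n)

theorem chartForm_mul {k : ℕ} (e : OpenPartialHomeomorph M 𝔼) {U : Opens M} (f : M → ℝ)
    (α : ∀ x : U, AltForm n M k x) (y : 𝔼) :
    chartForm e (fun x : U => f x.1 • α x) y = f (e.symm y) • chartForm e α y := by
  by_cases h : e.symm y ∈ U
  · rw [chartForm_eq e _ h rfl, chartForm_eq e α h rfl]
    rfl
  · simp [chartForm, h]

variable [IsManifold (𝓡 n) ∞ M]

theorem IsSmoothForm.mul {k : ℕ} {U : Opens M} {f : M → ℝ} (hf : ContMDiff (𝓡 n) 𝓘(ℝ) ∞ f)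
    {α : ∀ x : U, AltForm n M k x} (hα : IsSmoothForm α) :
    IsSmoothForm fun x : U => f x.1 • α x := fun e he y hy => by
  have h1 : ContDiffAt ℝ ∞ (f ∘ e.symm) y :=
    (hf.contMDiffAt.comp y (contMDiffAt_chart_symm he hy.1)).contDiffAt
  exact ((h1.smul (hα.contDiffAt he hy)).congr_of_eventuallyEq
    (.of_forall fun z => chartForm_mul e f α z)).contDiffWithinAt

variable (n M) in
/-- Multiplication of forms with smooth functions. -/
def formSheafMul (k : ℕ) : C^∞⟮𝓡 n, M; 𝓘(ℝ), ℝ⟯ →+ (formSheaf n M k ⟶ formSheaf n M k) where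
  toFun f := FunctionSheaf.homMk (S := smoothForms n M k) (S' := smoothForms n M k)
    (fun U =>
      { toFun := fun α => ⟨fun x => f x.1 • α.1 x,
          IsSmoothForm.mul (n := n) (M := M) (U := U) f.contMDiff α.2⟩
        map_add' := fun α β => Subtype.ext (funext fun x => smul_add _ _ _)
        map_smul' := fun c α => Subtype.ext (funext fun x => smul_comm (f x.1) c (α.1 x)) })
    (fun _ _ _ _ _ => rfl)
  map_zero' := by
    apply ObjectProperty.hom_ext
    ext U α
    exact Subtype.ext (funext fun x => zero_smul ℝ (α.1 x))
  map_add' f g := by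
    apply ObjectProperty.hom_ext
    ext U α
    exact Subtype.ext (funext fun x => add_smul (f x.1) (g x.1) (α.1 x))

theorem formSheafMul_one (k : ℕ) : formSheafMul n M k 1 = 𝟙 _ := by
  apply ObjectProperty.hom_ext
  ext U α
  exact Subtype.ext (funext fun x => one_smul ℝ (α.1 x))

theorem vanishesOn_formSheafMul (k : ℕ) {f : C^∞⟮𝓡 n, M; 𝓘(ℝ), ℝ⟯} {V : Opens M}
    (h : ∀ x ∈ V, f x = 0) : VanishesOn (X := TopCat.of M) (formSheafMul n M k f) V :=
  vanishesOn_of_sections fun W hW α => Subtype.ext (funext fun x => by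
    change f x.1 • α.1 x = 0
    rw [h x.1 (hW x.2), zero_smul])

variable (n M) in
-- Multiplication by the functions of a smooth partition of unity, indexed by the points like the
-- covering, gives the required endomorphisms.
theorem isFine_formSheaf [T2Space M] [SecondCountableTopology M] (k : ℕ) :
    IsFine (formSheaf n M k) := by
  have : LocallyCompactSpace M := ChartedSpace.locallyCompactSpace 𝔼 M
  intro U hU
  obtain ⟨ρ, hρ⟩ := SmoothPartitionOfUnity.exists_isSubordinate (𝓡 n) (isClosed_univ (X := M))
    (fun x => (U x : Set M)) (fun x => (U x).2) fun x _ => Set.mem_iUnion.2 ⟨x, hU x⟩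
  refine ⟨fun i => formSheafMul n M k (ρ i), fun i x hx => ?_, fun x => ?_⟩
  -- The closed support of `ρ i` lies in `U i`, so its complement is an open neighbourhood of every
  -- point outside `U i`.
  · refine ⟨⟨(tsupport (ρ i))ᶜ, (isClosed_tsupport _).isOpen_compl⟩, fun h => hx (hρ i h),
      vanishesOn_formSheafMul k fun y hy => image_eq_zero_of_notMem_tsupport hy⟩
  -- Local finiteness gives a neighbourhood met by finitely many supports; there the finite sum of
  -- the functions is `1`.
  · obtain ⟨t, ht, hfin⟩ := ρ.locallyFinite x
    obtain ⟨V, hVt, hV, hxV⟩ := mem_nhds_iff.1 ht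
    have hsupp : ∀ y ∈ V, ∀ i ∉ hfin.toFinset, ρ i y = 0 := fun y hy i hi => by
      by_contra h
      exact hi (hfin.mem_toFinset.2 ⟨y, h, hVt hy⟩)
    refine ⟨⟨V, hV⟩, hxV, hfin.toFinset, fun i hi =>
      vanishesOn_formSheafMul k fun y hy => hsupp y hy i hi, ?_⟩
    rw [← map_sum, ← formSheafMul_one, ← map_sub]
    refine vanishesOn_formSheafMul k fun y hy => ?_
    have h1 := ρ.sum_eq_one (Set.mem_univ y)
    rw [finsum_eq_sum_of_support_subset (s := hfin.toFinset) _ fun i hi => by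
      by_contra h
      exact hi (hsupp y hy i h)] at h1
    change (∑ i ∈ hfin.toFinset, ρ i : C^∞⟮𝓡 n, M; 𝓘(ℝ), ℝ⟯) y - 1 = 0
    rw [sub_eq_zero, ← h1, ← ContMDiffMap.coeFnAddMonoidHom_apply, map_sum, Finset.sum_apply]
    rfl

variable (n M) in
/-- The hypercohomology of the de Rham complex is de Rham cohomology. -/
theorem isIso_deRhamToHypercohomology [T2Space M] [SecondCountableTopology M] (k : ℕ) :
    IsIso (deRhamToHypercohomology n M k) :=
  isIso_homologyMap_sectionsToHyper (deRhamComplex n M) (isFine_formSheaf n M) k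

variable (n M) in
/-- The hypercohomology of the de Rham complex is the cohomology of the constant sheaf. -/
theorem isIso_sheafToHypercohomology (k : ℕ) : IsIso (sheafToHypercohomology n M k) :=
  -- The target is `formSheaf n M 0` only after unfolding the complex, so the instance is restated
  -- for the term of the complex.
  have : Mono (Y := (deRhamComplex n M).X 0) (realToForm n M) := realToForm_mono
  isIso_homologyMap_godementToHyper (deRhamComplex n M) (realToForm n M) (realToForm_d n M)
    (realToForm_exact n M) (deRhamComplex_exact n M) k

end FormsFine

end DeRham

end

/-- On a smooth manifold `M` (Hausdorff, second countable, of dimension `n`), the canonical maps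
`H_dRᵏ(M) → ℍᵏ(M, 𝒜^•)` and `Hᵏ(M, ℝ) → ℍᵏ(M, 𝒜^•)` to the hypercohomology of the de Rham
complex of sheaves are isomorphisms, and so there is exactly one isomorphism
`H_dRᵏ(M) ≅ Hᵏ(M, ℝ)` which is compatible with them. -/
theorem theoremt (n : ℕ) (M : Type u) [TopologicalSpace M]
    [ChartedSpace (EuclideanSpace ℝ (Fin n)) M] [IsManifold (𝓡 n) ∞ M]
    [T2Space M] [SecondCountableTopology M] (k : ℕ) :
    IsIso (DeRham.deRhamToHypercohomology n M k) ∧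
    IsIso (DeRham.sheafToHypercohomology n M k) ∧
    ∃! e : DeRham.deRhamCohomology n M k ≅ DeRham.sheafCohomology (DeRham.realSheaf (TopCat.of M)) k,
      e.hom ≫ DeRham.sheafToHypercohomology n M k = DeRham.deRhamToHypercohomology n M k := by
  have h1 := DeRham.isIso_deRhamToHypercohomology n M k
  have h2 := DeRham.isIso_sheafToHypercohomology n M k
  refine ⟨h1, h2, asIso (DeRham.deRhamToHypercohomology n M k) ≪≫
    (asIso (DeRham.sheafToHypercohomology n M k)).symm, by simp, fun e he => ?_⟩
  apply Iso.ext
  rw [← cancel_mono (DeRham.sheafToHypercohomology n M k), he]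
  simp
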